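/- Let $d\in\{1,2,3\}$ and $\kappa\in\{2,3,4\}$. On $\ell^2(\mathbb Z^d)$ let $(S_ju)(n)=u(n-e_j)$ be the shifts, let $(N_ju)(n)=n_ju(n)$, let $\Delta=\sum_{j=1}^d\frac12(S_j+S_j^*)$ be the standard Laplacian, and let $A_\kappa$ be the closure of the operator $$\sum_{j=1}^d\frac1{4i}\Big[(S_j^{\kappa}-S_j^{-\kappa})N_j+N_j(S_j^{\kappa}-S_j^{-\kappa})\Big]$$ defined on finitely supported sequences. Let $\mu_{A_\kappa}(\Delta)$ be the set of $E$ in the spectrum $\sigma(\Delta)$ for which there are an open interval $I\ni E$, a constant $\gamma>0$ and a sign $\pm$ such that the strict Mourre estimate $$E_I(\Delta)\,[\Delta,\pm iA_\kappa]_\circ\,E_I(\Delta)\ \ge\ \gamma\,E_I(\Delta)$$ holds, where $E_I(\Delta)$ is the spectral projection of $\Delta$ onto $I$ and $[\Delta,iA_\kappa]_\circ$ is the bounded operator on $\ell^2(\mathbb Z^d)$ that extends the commutator form. **Theorem.** The set $\mu_{A_\kappa}(\Delta)$ is symmetric about $0$. The set $O_{d,\kappa}$ below is included in $\mu_{A_\kappa}(\Delta)\cap[0,d]$,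 and the set $C_{d,\kappa}$ below is included in $[0,d]\setminus\mu_{A_\kappa}(\Delta)$. Moreover, except when $(d,\kappa)=(3,4)$, $\mu_{A_\kappa}(\Delta)=O_{d,\kappa}\cup(-O_{d,\kappa})$. Here - $O_{1,2}=(0,1)$, $O_{2,2}=(1,2)$, $O_{3,2}=(2,3)$; - $O_{1,3}=[0,1)\setminus\{\frac12\}$, $O_{2,3}=\big(\tfrac12\sqrt{\tfrac12(5-\sqrt7)},1\big)\cup(\tfrac32,2)$, $O_{3,3}=(\tfrac52,3)$; - $O_{1,4}=(0,1)\setminus\{\tfrac1{\sqrt2}\}$, $O_{2,4}=\big(\sqrt{\tfrac32-\tfrac1{\sqrt5}},\sqrt2\big)\cup(1+\tfrac{\sqrt2}2,2)$, $O_{3,4}=(2+\tfrac1{\sqrt2},3)$; - $C_{1,2}=\{0,1\}$, $C_{2,2}=[0,1]\cup\{2\}$, $C_{3,2}=[0,2]\cup\{3\}$; - $C_{1,3}=\{\tfrac12,1\}$, $C_{2,3}=\big[0,\tfrac12\sqrt{\tfrac12(5-\sqrt7)}\big]\cup[1,\tfrac32]\cup\{2\}$, $C_{3,3}=[0,\tfrac52]\cup\{3\}$;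 - $C_{1,4}=\{0,\tfrac1{\sqrt2},1\}$, $C_{2,4}=\big[0,\sqrt{\tfrac32-\tfrac1{\sqrt5}}\big]\cup[\sqrt2,1+\tfrac{\sqrt2}2]\cup\{2\}$, $C_{3,4}=[0,2]\cup[\tfrac3{\sqrt2},2+\tfrac1{\sqrt2}]\cup\{3\}$. -/

import Mathlib

noncomputable section

namespace LatticeMourre

open Set

/-! ### Strict Mourre estimates in an abstract Hilbert space -/

section Abstract

variable {H : Type*} [NormedAddCommGroup H] [InnerProductSpace ℂ H] [CompleteSpace H]

/-- The range of the spectral projection of the bounded self-adjoint operator `T` onto an open set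
`I ⊆ ℝ`: the closed linear span of the ranges of `f(T)`, where `f` runs over the continuous
functions on `ℝ` that vanish outside `I`.  (For `I` open, the indicator of `I` is the increasing
pointwise limit of such functions, so that the spectral projection is the strong limit of the
corresponding `f(T)`.) -/
def spectralSubspace (T : H →L[ℂ] H) (I : Set ℝ) : Submodule ℂ H :=
  (⨆ f : {f : ℝ → ℝ // Continuous f ∧ ∀ x ∉ I, f x = 0},
    LinearMap.range (cfc f.1 T : H →L[ℂ] H).toLinearMap).topologicalClosure

instance (T : H →L[ℂ] H) (I : Set ℝ) : CompleteSpace (spectralSubspace T I) :=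
  (Submodule.isClosed_topologicalClosure _).completeSpace_coe

/-- The spectral projection `E_I(T)` of the bounded self-adjoint operator `T` onto an open set `I`:
the orthogonal projection onto `spectralSubspace T I`, as a bounded operator on `H`. -/
def spectralProj (T : H →L[ℂ] H) (I : Set ℝ) : H →L[ℂ] H :=
  (spectralSubspace T I).starProjection

/-- The bounded operator `C` is `[T, iA]_∘`: it extends the commutator form
`⟨ψ, [T, iA] φ⟩ = i (⟨T ψ, A φ⟩ - ⟨A ψ, T φ⟩)`, `ψ, φ ∈ Dom A`. -/
def IsCommutator (T : H →L[ℂ] H) (A : H →ₗ.[ℂ] H) (C : H →L[ℂ] H) : Prop :=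
  ∀ ψ φ : A.domain,
    inner ℂ (ψ : H) (C φ) = Complex.I * (inner ℂ (T ψ) (A φ) - inner ℂ (A ψ) (T φ))

/-- The strict Mourre estimate `E_I(T) [T, iA]_∘ E_I(T) ≥ γ E_I(T)` (in particular the commutator
form extends to a bounded operator). -/
def StrictMourreEstimate (T : H →L[ℂ] H) (A : H →ₗ.[ℂ] H) (I : Set ℝ) (γ : ℝ) : Prop :=
  ∃ C : H →L[ℂ] H, IsCommutator T A C ∧
    (γ : ℂ) • spectralProj T I ≤ spectralProj T I * C * spectralProj T I

/-- The set `μ_A⁺(T)` of the points of the spectrum of `T` that lie in an open interval on which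
the strict Mourre estimate holds with respect to `A`. -/
def mourreSetPos (T : H →L[ℂ] H) (A : H →ₗ.[ℂ] H) : Set ℝ :=
  {E | E ∈ spectrum ℝ T ∧ ∃ I : Set ℝ, IsOpen I ∧ I.OrdConnected ∧ E ∈ I ∧
    ∃ γ : ℝ, 0 < γ ∧ StrictMourreEstimate T A I γ}

/-- The set `μ_A(T) = μ_A⁺(T) ∪ μ_A⁻(T)`, where `μ_A⁻(T) = μ_{-A}⁺(T)`. -/
def mourreSet (T : H →L[ℂ] H) (A : H →ₗ.[ℂ] H) : Set ℝ :=
  mourreSetPos T A ∪ mourreSetPos T (-A)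

end Abstract

/-! ### The standard Laplacian and the conjugate operators on `ℓ²(ℤᵈ)` -/

/-- The Hilbert space `ℓ²(ℤᵈ)`. -/
abbrev L2 (d : ℕ) : Type := lp (fun _ : Fin d → ℤ => ℂ) 2

/-- The translation `(shift v u)(n) = u(n - v)` of `ℓ²(ℤᵈ)`.  For `v = m e_j` it is the power
`S_j ^ m` of the shift `S_j` to the right along the `j`-th coordinate. -/
def shift {d : ℕ} (v : Fin d → ℤ) : L2 d →ₗᵢ[ℂ] L2 d where
  toFun u := ⟨fun n => u (n - v), by
    have h := (memℓp_gen_iff (p := 2) (by norm_num)).1 (lp.memℓp u)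
    exact (memℓp_gen_iff (p := 2) (by norm_num)).2
      ((Equiv.subRight v).summable_iff.2 h)⟩
  map_add' _ _ := rfl
  map_smul' _ _ := rfl
  norm_map' u := by
    have h2 : (0 : ℝ) < (2 : ENNReal).toReal := by norm_num
    simp only [lp.norm_eq_tsum_rpow h2]
    congr 1
    exact (Equiv.subRight v).tsum_eq (fun n => ‖u n‖ ^ (2 : ENNReal).toReal)

@[simp]
theorem shift_apply {d : ℕ} (v : Fin d → ℤ) (u : L2 d) (n : Fin d → ℤ) :
    shift v u n = u (n - v) := rfl

/-- The shift `S_j` to the right on the `j`-th coordinate. -/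
def rightShift {d : ℕ} (j : Fin d) : L2 d →L[ℂ] L2 d :=
  (shift (Pi.single j 1)).toContinuousLinearMap

/-- The standard Laplacian `Δ = ∑ⱼ (S_j + S_j⋆) / 2` on `ℓ²(ℤᵈ)`. -/
def laplacian (d : ℕ) : L2 d →L[ℂ] L2 d :=
  ∑ j : Fin d, (1 / 2 : ℂ) • (rightShift j + ContinuousLinearMap.adjoint (rightShift j))

/-- The space `ℓ₀(ℤᵈ)` of finitely supported sequences. -/
def finSupp (d : ℕ) : Submodule ℂ (L2 d) where
  carrier := {u | (Function.support (u : (Fin d → ℤ) → ℂ)).Finite}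
  add_mem' {u v} hu hv := (hu.union hv).subset (Function.support_add _ _)
  zero_mem' := by
    change (Function.support (fun _ : Fin d → ℤ => (0 : ℂ))).Finite
    simp
  smul_mem' c u hu := Set.Finite.subset hu (Function.support_const_smul_subset c _)

/-- The power `S_j ^ m`, `m ∈ ℤ`, as an operator on `ℓ₀(ℤᵈ)`: `(S_j ^ m u)(n) = u(n - m e_j)`. -/
def shiftFin {d : ℕ} (j : Fin d) (m : ℤ) : finSupp d →ₗ[ℂ] finSupp d :=
  (shift (Pi.single j m)).toLinearMap.restrict (fun u hu => by
    exact Set.Finite.preimage (Equiv.subRight (Pi.single j m)).injective.injOn hu)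

/-- The position operator on `ℓ₀(ℤᵈ)`: `(N_j u)(n) = n_j u(n)`. -/
def positionFin {d : ℕ} (j : Fin d) : finSupp d →ₗ[ℂ] finSupp d where
  toFun u :=
    have hf : (Function.support fun n : Fin d → ℤ => (n j : ℂ) * u.1 n).Finite :=
      Set.Finite.subset u.2 (Function.support_mul_subset_right _ _)
    ⟨⟨fun n => (n j : ℂ) * u.1 n, (memℓp_zero hf).of_exponent_ge zero_le⟩, hf⟩
  map_add' u v := by
    ext n
    exact mul_add _ _ _
  map_smul' c u := by
    ext n
    exact mul_left_comm _ _ _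

/-- The operator `A_j = (4i)⁻¹ [(S_j^k - S_j^{-k}) N_j + N_j (S_j^k - S_j^{-k})]` on `ℓ₀(ℤᵈ)`. -/
def conjFin {d : ℕ} (k : ℕ) (j : Fin d) : finSupp d →ₗ[ℂ] finSupp d :=
  (1 / (4 * Complex.I)) •
    ((shiftFin j k - shiftFin j (-k)) ∘ₗ positionFin j +
      positionFin j ∘ₗ (shiftFin j k - shiftFin j (-k)))

/-- The conjugate operator `A_κ`, `κ = (κ_j)`: the closure in `ℓ²(ℤᵈ)` of `∑ⱼ A_j`, defined on
finitely supported sequences. -/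
def conjOp {d : ℕ} (κ : Fin d → ℕ) : L2 d →ₗ.[ℂ] L2 d :=
  LinearPMap.closure
    { domain := finSupp d
      toFun := (finSupp d).subtype ∘ₗ ∑ j : Fin d, conjFin (κ j) j }

/-- The set `μ_{A_κ}(Δ)` for the standard Laplacian on `ℓ²(ℤᵈ)` and `κ_j = κ` for all `j`. -/
def muLaplacian (d κ : ℕ) : Set ℝ :=
  mourreSet (laplacian d) (conjOp (fun _ : Fin d => κ))

/-! ### The bands of energies -/

/-- The listed sets of energies in `[0, d]` at which the strict Mourre estimate holds; the first
argument is the dimension `d`, the second is `κ`. -/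
def openBands : ℕ → ℕ → Set ℝ
  | 1, 2 => Ioo 0 1
  | 2, 2 => Ioo 1 2
  | 3, 2 => Ioo 2 3
  | 1, 3 => Ico 0 1 \ {1 / 2}
  | 2, 3 => Ioo (1 / 2 * √(1 / 2 * (5 - √7))) 1 ∪ Ioo (3 / 2) 2
  | 3, 3 => Ioo (5 / 2) 3
  | 1, 4 => Ioo 0 1 \ {1 / √2}
  | 2, 4 => Ioo (√(3 / 2 - 1 / √5)) (√2) ∪ Ioo (1 + √2 / 2) 2
  | 3, 4 => Ioo (2 + 1 / √2) 3
  | _, _ => ∅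

/-- The listed sets of energies in `[0, d]` at which the strict Mourre estimate fails; the first
argument is the dimension `d`, the second is `κ`. -/
def closedBands : ℕ → ℕ → Set ℝ
  | 1, 2 => {0, 1}
  | 2, 2 => Icc 0 1 ∪ {2}
  | 3, 2 => Icc 0 2 ∪ {3}
  | 1, 3 => {1 / 2, 1}
  | 2, 3 => Icc 0 (1 / 2 * √(1 / 2 * (5 - √7))) ∪ Icc 1 (3 / 2) ∪ {2}
  | 3, 3 => Icc 0 (5 / 2) ∪ {3}
  | 1, 4 => {0, 1 / √2, 1}
  | 2, 4 => Icc 0 (√(3 / 2 - 1 / √5)) ∪ Icc (√2) (1 + √2 / 2) ∪ {2}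
  | 3, 4 => Icc 0 2 ∪ Icc (3 / √2) (2 + 1 / √2) ∪ {3}
  | _, _ => ∅

end LatticeMourre

end

/-! ### Mourre estimates for operators with a continuous symbol -/

namespace LatticeMourre

open Set

section Symbol

variable {X : Type*} [TopologicalSpace X]

/-! The Fourier transform diagonalises the problem. On the torus `Δ` becomes multiplication by `e =
∑ⱼ cos ξⱼ`. The position-dependent parts of the commutator cancel, so `[Δ, iA_κ]_∘` is again a
polynomial in the shifts, namely multiplication by `g = ∑ⱼ sin ξⱼ sin κξⱼ`. This bounded extension
is unique, because finitely supported sequences are dense (`isCommutator_conjOp_iff`).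

For two multiplication operators, a strict Mourre estimate near `E` holds if and only if `g > 0` on
the level set `{e = E}` (`mem_mourreSetPos_iff`). Compactness spreads positivity to a neighbourhood
of energies. Conversely, a test function concentrated near a point where `g ≤ 0` violates the
estimate. Only an injective star homomorphism from the continuous functions into the operators is
needed.

With `cⱼ = cos ξⱼ`, each summand of `g` is the polynomial `commPoly κ cⱼ`. Thus `E` belongs to the
Mourre set exactly when `∑ⱼ commPoly κ cⱼ` keeps a strict sign on the slice `∑ⱼ cⱼ = E` of the cube
`[-1, 1]^d` (`mem_muLaplacian_iff`). The parity of `commPoly κ` gives the symmetry about `0`.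

The bands adjacent to `d` are those where every coordinate lies beyond the last zero of `commPoly κ`
below `1`. The inner two-dimensional bands come from writing the sum as a quadratic in the product
`xy` at fixed `x + y`, and completing the square. All failures are witnessed by two points of one
slice with opposite weak signs. Outside `(d, κ) = (3, 4)` the two lists cover `[0, d]`, which makes
them complete. -/

/-- A real continuous function, viewed as a complex one. -/
def realSymbol (f : C(X, ℝ)) : C(X, ℂ) := ⟨fun x => (f x : ℂ), by fun_prop⟩

@[simp]
theorem realSymbol_apply (f : C(X, ℝ)) (x : X) : realSymbol f x = (f x : ℂ) := rfl

theorem realSymbol_mul (f g : C(X, ℝ)) :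
    realSymbol (f * g) = realSymbol f * realSymbol g := by
  ext x; simp

theorem isSelfAdjoint_realSymbol (f : C(X, ℝ)) : IsSelfAdjoint (realSymbol f) := by
  ext x; simp

/-- Evaluation at a point is a star homomorphism to `ℂ`, so it commutes with the functional
calculus; for a scalar that calculus is just application of the function. -/
theorem cfc_realSymbol [CompactSpace X] (e : C(X, ℝ)) {f : ℝ → ℝ} (hf : Continuous f) :
    cfc (fun z : ℂ => (f z.re : ℂ)) (realSymbol e) = realSymbol ((⟨f, hf⟩ : C(ℝ, ℝ)).comp e) := by
  ext x
  have hc : Continuous (fun z : ℂ => (f z.re : ℂ)) := by fun_prop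
  have h := StarAlgHomClass.map_cfc (S := ℂ) (ContinuousMap.evalStarAlgHom ℂ ℂ x)
    (fun z : ℂ => (f z.re : ℂ)) (realSymbol e) hc.continuousOn
    (ContinuousEvalConst.continuous_eval_const x) (isSelfAdjoint_realSymbol e).isStarNormal
    ((isSelfAdjoint_realSymbol e).map _).isStarNormal
  have h1 : ContinuousMap.evalStarAlgHom ℂ ℂ x (realSymbol e) = algebraMap ℂ ℂ (e x) := rfl
  rw [h1, cfc_algebraMap] at h
  exact h

variable {H : Type*} [NormedAddCommGroup H] [InnerProductSpace ℂ H] [CompleteSpace H]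
  (Φ : C(X, ℂ) →⋆ₐ[ℂ] (H →L[ℂ] H))

theorem map_realSymbol_nonneg {f : C(X, ℝ)} (hf : ∀ x, 0 ≤ f x) : 0 ≤ Φ (realSymbol f) := by
  set s : C(X, ℝ) := ⟨fun x => √(f x), by fun_prop⟩
  have h : realSymbol f = star (realSymbol s) * realSymbol s := by
    rw [(isSelfAdjoint_realSymbol s).star_eq, ← realSymbol_mul]
    congr 1
    ext x
    exact (Real.mul_self_sqrt (hf x)).symm
  rw [h, map_mul, map_star]
  exact star_mul_self_nonneg _

theorem re_inner_map_realSymbol_mono {f g : C(X, ℝ)} (h : ∀ x, f x ≤ g x) (u : H) :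
    (inner ℂ u (Φ (realSymbol f) u)).re ≤ (inner ℂ u (Φ (realSymbol g) u)).re := by
  have h1 := map_realSymbol_nonneg Φ (f := g - f) (fun x => sub_nonneg.2 (h x))
  have h2 : realSymbol (g - f) = realSymbol g - realSymbol f := by ext x; simp
  rw [h2, map_sub, ContinuousLinearMap.nonneg_iff_isPositive,
    ContinuousLinearMap.isPositive_def'] at h1
  have h3 := h1.2 u
  rw [ContinuousLinearMap.reApplyInnerSelf_apply, inner_re_symm, sub_apply,
    inner_sub_right, map_sub] at h3
  exact sub_nonneg.1 h3

theorem re_inner_map_const (c : ℝ) (u : H) :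
    (inner ℂ u (Φ (realSymbol (ContinuousMap.const X c)) u)).re = c * ‖u‖ ^ 2 := by
  have h : realSymbol (ContinuousMap.const X c) = algebraMap ℂ C(X, ℂ) c := rfl
  rw [h, AlgHomClass.commutes, Algebra.algebraMap_eq_smul_one, smul_apply,
    one_apply_eq_self, inner_smul_right]
  have h2 : inner ℂ u u = ((‖u‖ ^ 2 : ℝ) : ℂ) := by
    rw [inner_self_eq_norm_sq_to_K]
    norm_cast
  rw [h2, ← Complex.ofReal_mul, Complex.ofReal_re]

variable [CompactSpace X]

open scoped CStarAlgebra in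
theorem cfc_map_realSymbol (e : C(X, ℝ)) {f : ℝ → ℝ} (hf : Continuous f) :
    cfc f (Φ (realSymbol e)) = Φ (realSymbol ((⟨f, hf⟩ : C(ℝ, ℝ)).comp e)) := by
  have hc : Continuous (fun z : ℂ => (f z.re : ℂ)) := by fun_prop
  have hT : IsSelfAdjoint (Φ (realSymbol e)) := (isSelfAdjoint_realSymbol e).map Φ
  rw [← cfc_realSymbol e hf, cfc_real_eq_complex f hT]
  exact (StarAlgHomClass.map_cfc (S := ℂ) Φ _ (realSymbol e) hc.continuousOn
    (map_continuous Φ) (isSelfAdjoint_realSymbol e).isStarNormal hT.isStarNormal).symm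

/-- Off the range of `e` the function `E - e` is invertible, hence so is its image. On the range, a
function vanishing exactly on the spectrum would give a zero operator, and injectivity of `Φ` would
make it vanish at `e x` too. -/
theorem mem_spectrum_map_realSymbol_iff (hΦ : Function.Injective Φ) (e : C(X, ℝ)) (E : ℝ) :
    E ∈ spectrum ℝ (Φ (realSymbol e)) ↔ E ∈ range e := by
  constructor
  · intro h
    by_contra hE
    rw [← spectrum.algebraMap_mem_iff ℂ] at h
    have h2 : IsUnit (algebraMap ℂ C(X, ℂ) E - realSymbol e) := by
      rw [ContinuousMap.isUnit_iff_forall_ne_zero]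
      intro x hx
      apply hE
      refine ⟨x, ?_⟩
      have : (E : ℂ) - (e x : ℂ) = 0 := hx
      exact_mod_cast (sub_eq_zero.1 this).symm
    have h3 := h2.map Φ
    rw [map_sub, AlgHomClass.commutes] at h3
    exact h h3
  · rintro ⟨x, rfl⟩
    by_contra h
    set T := Φ (realSymbol e)
    -- The extra point keeps the set nonempty, since the distance to the empty set is `0` by
    -- convention. It differs from `e x`, so it does no harm.
    have hne : (insert (e x + 1) (spectrum ℝ T)).Nonempty := ⟨_, mem_insert _ _⟩
    set f : ℝ → ℝ := fun t => Metric.infDist t (insert (e x + 1) (spectrum ℝ T))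
    have hf : Continuous f := Metric.continuous_infDist_pt _
    have h0 : cfc f T = 0 := by
      rw [cfc_congr (g := fun _ => 0) (a := T) (f := f), cfc_const_zero]
      intro t ht
      exact Metric.infDist_zero_of_mem (mem_insert_of_mem _ ht)
    rw [cfc_map_realSymbol Φ e hf, ← map_zero Φ] at h0
    have h1 : ((f (e x) : ℝ) : ℂ) = 0 := DFunLike.congr_fun (hΦ h0) x
    have hcl : IsClosed (insert (e x + 1) (spectrum ℝ T)) := by
      rw [insert_eq]
      exact isClosed_singleton.union (spectrum.isClosed (𝕜 := ℝ) T)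
    have h2 : e x ∈ insert (e x + 1) (spectrum ℝ T) :=
      (hcl.mem_iff_infDist_zero hne).2 (by exact_mod_cast h1)
    rcases h2 with h2 | h2
    · linarith
    · exact h h2

/-! ### Spectral subspaces and the strict estimate as a form inequality -/

theorem cfc_apply_mem_spectralSubspace (T : H →L[ℂ] H) {I : Set ℝ} {f : ℝ → ℝ}
    (hf : Continuous f) (hI : ∀ x ∉ I, f x = 0) (u : H) :
    (cfc f T : H →L[ℂ] H) u ∈ spectralSubspace T I :=
  Submodule.le_topologicalClosure _ <|
    Submodule.mem_iSup_of_mem (p := fun f : {f : ℝ → ℝ // Continuous f ∧ ∀ x ∉ I, f x = 0} =>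
      LinearMap.range (cfc f.1 T : H →L[ℂ] H).toLinearMap) ⟨f, hf, hI⟩ ⟨u, rfl⟩

theorem eqOn_spectralSubspace {T B C : H →L[ℂ] H} {I : Set ℝ}
    (h : ∀ f : ℝ → ℝ, Continuous f → (∀ x ∉ I, f x = 0) → B * cfc f T = C * cfc f T) :
    ∀ u ∈ spectralSubspace T I, B u = C u := by
  have hle : spectralSubspace T I ≤ LinearMap.eqLocus B.toLinearMap C.toLinearMap := by
    refine Submodule.topologicalClosure_minimal _ (iSup_le ?_) ?_
    · rintro ⟨f, hf, hI⟩ _ ⟨u, rfl⟩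
      exact DFunLike.congr_fun (h f hf hI) u
    · exact isClosed_eq B.continuous C.continuous
  exact fun u hu => hle hu

/-- The projection `P` is self-adjoint and idempotent, so the form of `P C P - γ P` at `u` is the
form of `C - γ` at `P u`. -/
theorem smul_spectralProj_le_iff (T C : H →L[ℂ] H) (hC : IsSelfAdjoint C) (I : Set ℝ) (γ : ℝ) :
    (γ : ℂ) • spectralProj T I ≤ spectralProj T I * C * spectralProj T I ↔
      ∀ u ∈ spectralSubspace T I, γ * ‖u‖ ^ 2 ≤ (inner ℂ u (C u)).re := by
  set P := spectralProj T I
  have hP : IsSelfAdjoint P := isSelfAdjoint_starProjection _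
  have hPP : P * P = P := (Submodule.isIdempotentElem_starProjection _).eq
  have hadj (u v : H) : inner ℂ u (P v) = inner ℂ (P u) v := by
    conv_rhs => rw [← hP.adjoint_eq]
    rw [ContinuousLinearMap.adjoint_inner_left]
  have key (u : H) : (inner ℂ u ((P * C * P - (γ : ℂ) • P) u)).re =
      (inner ℂ (P u) (C (P u))).re - γ * ‖P u‖ ^ 2 := by
    have h1 : P u = P (P u) := (DFunLike.congr_fun hPP u).symm
    have h2 : inner ℂ u ((P * C * P) u) = inner ℂ (P u) (C (P u)) := hadj u _
    have h3 : inner ℂ u (P u) = ((‖P u‖ ^ 2 : ℝ) : ℂ) := by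
      rw [h1, hadj, ← h1, inner_self_eq_norm_sq_to_K]
      norm_cast
    rw [sub_apply, smul_apply, inner_sub_right, inner_smul_right, Complex.sub_re, h2, h3,
      ← Complex.ofReal_mul, Complex.ofReal_re]
  rw [ContinuousLinearMap.le_def, ContinuousLinearMap.isPositive_def']
  constructor
  · rintro ⟨-, h⟩ u hu
    have h2 := h u
    have hu' : P u = u := Submodule.starProjection_eq_self_iff.2 hu
    rw [ContinuousLinearMap.reApplyInnerSelf_apply, inner_re_symm] at h2
    have h3 := key u
    rw [hu'] at h3
    have h4 : 0 ≤ (inner ℂ u ((P * C * P - (γ : ℂ) • P) u)).re := h2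
    linarith
  · intro h
    refine ⟨?_, fun u => ?_⟩
    · refine IsSelfAdjoint.sub ?_ ?_
      · have := hC.conjugate P
        rwa [hP.star_eq] at this
      · exact IsSelfAdjoint.smul (Complex.conj_ofReal γ) hP
    · rw [ContinuousLinearMap.reApplyInnerSelf_apply, inner_re_symm]
      have h3 := key u
      have h4 := h (P u) (Submodule.starProjection_apply_mem _ u)
      have h5 : 0 ≤ (inner ℂ u ((P * C * P - (γ : ℂ) • P) u)).re := by linarith
      exact h5

/-- On the compact level set `g` exceeds some `γ > 0`. The image under `e` of the compact set `{g ≤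
γ}` is closed and misses `E`, so a ball around `E` avoids it. -/
theorem exists_isOpen_forall_le (e g : C(X, ℝ)) {E : ℝ} (h : ∀ x, e x = E → 0 < g x) :
    ∃ I : Set ℝ, IsOpen I ∧ I.OrdConnected ∧ E ∈ I ∧
      ∃ γ : ℝ, 0 < γ ∧ ∀ x, e x ∈ I → γ ≤ g x := by
  have hK : IsCompact {x | e x = E} := (isClosed_eq e.continuous continuous_const).isCompact
  obtain ⟨γ, hγ, hγK⟩ : ∃ γ : ℝ, 0 < γ ∧ ∀ x, e x = E → γ < g x := by
    rcases {x | e x = E}.eq_empty_or_nonempty with h0 | h0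
    · exact ⟨1, one_pos, fun x hx => (h0.subset hx : x ∈ (∅ : Set X)).elim⟩
    · obtain ⟨x, hx, hmin⟩ := hK.exists_isMinOn h0 g.continuous.continuousOn
      refine ⟨g x / 2, half_pos (h x hx), fun y hy => ?_⟩
      have h1 : g x ≤ g y := hmin hy
      have := h x hx
      linarith
  have hL : IsCompact (e '' {x | g x ≤ γ}) :=
    (isClosed_le g.continuous continuous_const).isCompact.image e.continuous
  have hE : E ∈ (e '' {x | g x ≤ γ})ᶜ := by
    rintro ⟨x, hx, hxE⟩
    exact absurd (hγK x hxE) (not_lt.2 hx)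
  obtain ⟨ε, hε, hball⟩ := Metric.isOpen_iff.1 hL.isClosed.isOpen_compl E hE
  refine ⟨Metric.ball E ε, Metric.isOpen_ball, (convex_ball E ε).ordConnected,
    Metric.mem_ball_self hε, γ, hγ, fun x hx => ?_⟩
  by_contra hlt
  exact hball hx ⟨x, (not_le.1 hlt).le, rfl⟩

/-- On the spectral subspace of `I` only the values of `g` over `e ⁻¹' I` matter, so `g` may be
replaced by `max g γ`, which is at least `γ` everywhere. -/
theorem smul_spectralProj_le_of_le {e g : C(X, ℝ)} {I : Set ℝ} {γ : ℝ}
    (h : ∀ x, e x ∈ I → γ ≤ g x) :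
    (γ : ℂ) • spectralProj (Φ (realSymbol e)) I ≤
      spectralProj (Φ (realSymbol e)) I * Φ (realSymbol g) *
        spectralProj (Φ (realSymbol e)) I := by
  rw [smul_spectralProj_le_iff _ _ ((isSelfAdjoint_realSymbol g).map Φ)]
  intro u hu
  rw [eqOn_spectralSubspace (C := Φ (realSymbol (g ⊔ ContinuousMap.const X γ))) ?_ u hu,
    ← re_inner_map_const Φ]
  · exact re_inner_map_realSymbol_mono Φ (fun x => le_sup_right) u
  · intro f hf hI
    rw [cfc_map_realSymbol Φ e hf, ← map_mul, ← map_mul, ← realSymbol_mul, ← realSymbol_mul]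
    congr 2
    ext x
    by_cases hx : e x ∈ I
    · simp [h x hx]
    · simp [hI _ hx]

/-- If `g x ≤ 0`, take `φ = (f ∘ e) χ` with `f` a bump in `I` around `e x` and `χ` vanishing where
`g ≥ γ / 2`. On the range of `Φ φ` the form of `Φ g` is both at least `γ ‖u‖²` and at most `γ / 2
‖u‖²`. Hence `Φ φ = 0`, although `φ x > 0`. -/
theorem lt_of_smul_spectralProj_le (hΦ : Function.Injective Φ) {e g : C(X, ℝ)} {I : Set ℝ} {γ : ℝ}
    (hγ : 0 < γ) (hI : IsOpen I)
    (h : (γ : ℂ) • spectralProj (Φ (realSymbol e)) I ≤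
      spectralProj (Φ (realSymbol e)) I * Φ (realSymbol g) *
        spectralProj (Φ (realSymbol e)) I) {x : X} (hx : e x ∈ I) : 0 < g x := by
  by_contra hg
  push Not at hg
  rw [smul_spectralProj_le_iff _ _ ((isSelfAdjoint_realSymbol g).map Φ)] at h
  obtain ⟨ε, hε, hball⟩ := Metric.isOpen_iff.1 hI _ hx
  set f : C(ℝ, ℝ) := ⟨fun t => max (ε - |t - e x|) 0, by fun_prop⟩
  set χ : C(X, ℝ) := ⟨fun y => max (γ / 2 - g y) 0, by fun_prop⟩
  have hfI : ∀ t ∉ I, f t = 0 := fun t ht => by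
    have : t ∉ Metric.ball (e x) ε := fun h => ht (hball h)
    rw [Metric.mem_ball, Real.dist_eq, not_lt] at this
    exact max_eq_right (by linarith)
  set φ : C(X, ℝ) := f.comp e * χ
  have hφ : Φ (realSymbol φ) = 0 := by
    ext1 w
    set u := Φ (realSymbol φ) w
    have hu : u ∈ spectralSubspace (Φ (realSymbol e)) I := by
      have h1 := cfc_apply_mem_spectralSubspace (Φ (realSymbol e)) f.continuous hfI
        (Φ (realSymbol χ) w)
      rw [cfc_map_realSymbol Φ e f.continuous, ← mul_apply_eq_comp, ← map_mul,
        ← realSymbol_mul] at h1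
      exact h1
    have h1 := h u hu
    have hmove (k : C(X, ℝ)) : inner ℂ u (Φ (realSymbol k) u) =
        inner ℂ w (Φ (realSymbol (φ * (k * φ))) w) := by
      rw [realSymbol_mul φ, realSymbol_mul k, map_mul, map_mul, mul_apply_eq_comp,
        mul_apply_eq_comp]
      conv_rhs => rw [← ((isSelfAdjoint_realSymbol φ).map Φ).adjoint_eq,
        ContinuousLinearMap.adjoint_inner_right]
      rw [((isSelfAdjoint_realSymbol φ).map Φ).adjoint_eq]
    have h2 : (inner ℂ u (Φ (realSymbol g) u)).re ≤ γ / 2 * ‖u‖ ^ 2 := by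
      rw [← re_inner_map_const Φ, hmove, hmove]
      refine re_inner_map_realSymbol_mono Φ (fun y => ?_) w
      change φ y * (g y * φ y) ≤ φ y * (γ / 2 * φ y)
      by_cases hy : g y ≤ γ / 2
      · nlinarith [mul_self_nonneg (φ y)]
      · have : φ y = 0 := by
          change f (e y) * max (γ / 2 - g y) 0 = 0
          rw [max_eq_right (by linarith), mul_zero]
        simp [this]
    have h3 : ‖u‖ ^ 2 ≤ 0 := by nlinarith
    have h4 : ‖u‖ = 0 := by
      have := sq_nonneg ‖u‖
      exact pow_eq_zero_iff (two_ne_zero) |>.1 (le_antisymm h3 this)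
    exact norm_eq_zero.1 h4
  have h5 : ((φ x : ℝ) : ℂ) = 0 := DFunLike.congr_fun (hΦ (hφ.trans (map_zero Φ).symm)) x
  have h6 : max (ε - |e x - e x|) 0 * max (γ / 2 - g x) 0 = 0 := by exact_mod_cast h5
  rw [sub_self, abs_zero, sub_zero, max_eq_left hε.le, max_eq_left (by linarith)] at h6
  nlinarith

/-- The strict Mourre estimate holds exactly at the energies at which the symbol of the commutator
is positive on the whole constant energy surface. -/
theorem mem_mourreSetPos_iff (hΦ : Function.Injective Φ) (e g : C(X, ℝ)) (A : H →ₗ.[ℂ] H)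
    (hA : ∀ C, IsCommutator (Φ (realSymbol e)) A C ↔ C = Φ (realSymbol g)) (E : ℝ) :
    E ∈ mourreSetPos (Φ (realSymbol e)) A ↔ E ∈ range e ∧ ∀ x, e x = E → 0 < g x := by
  rw [mourreSetPos, mem_ofPred_eq, mem_spectrum_map_realSymbol_iff Φ hΦ]
  refine and_congr_right fun _ => ⟨?_, fun h => ?_⟩
  · rintro ⟨I, hI, -, hE, γ, hγ, C, hC, h⟩ x rfl
    rw [(hA C).1 hC] at h
    exact lt_of_smul_spectralProj_le Φ hΦ hγ hI h hE
  · obtain ⟨I, hI, hI', hE, γ, hγ, hle⟩ := exists_isOpen_forall_le e g h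
    exact ⟨I, hI, hI', hE, γ, hγ, _, (hA _).2 rfl, smul_spectralProj_le_of_le Φ hle⟩

end Symbol

end LatticeMourre

/-! ### Fourier series and multiplication operators on the torus -/

noncomputable section

namespace LatticeMourre

open Set MeasureTheory UnitAddTorus
open scoped ENNReal

section Multiplication

variable {X : Type*} [TopologicalSpace X] [CompactSpace X] [MeasurableSpace X] [BorelSpace X]
  (μ : Measure X) [IsFiniteMeasure μ]

/-- The operator of multiplication by a continuous function on `L²`. -/
def mulOp (f : C(X, ℂ)) : Lp ℂ 2 μ →L[ℂ] Lp ℂ 2 μ :=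
  (ContinuousLinearMap.mul ℂ ℂ).holderL μ ∞ 2 2 (ContinuousMap.toLp ∞ μ ℂ f)

theorem coeFn_mulOp (f : C(X, ℂ)) (u : Lp ℂ 2 μ) : mulOp μ f u =ᵐ[μ] fun x => f x * u x := by
  have h := (ContinuousLinearMap.mul ℂ ℂ).coeFn_holder (r := 2) (ContinuousMap.toLp ∞ μ ℂ f) u
  filter_upwards [h, ContinuousMap.coeFn_toLp (p := ∞) (𝕜 := ℂ) μ f] with x h1 h2
  rw [← h2]
  exact h1

theorem mulOp_mul (f g : C(X, ℂ)) : mulOp μ (f * g) = mulOp μ f * mulOp μ g := by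
  ext1 u
  apply Lp.ext
  filter_upwards [coeFn_mulOp μ (f * g) u, coeFn_mulOp μ f (mulOp μ g u), coeFn_mulOp μ g u]
    with x h1 h2 h3
  rw [h1, mul_apply_eq_comp, h2, h3, ContinuousMap.mul_apply, mul_assoc]

theorem mulOp_one : mulOp μ 1 = 1 := by
  ext1 u
  apply Lp.ext
  filter_upwards [coeFn_mulOp μ 1 u] with x h1
  rw [h1, ContinuousMap.one_apply, one_mul, one_apply_eq_self]

theorem mulOp_star (f : C(X, ℂ)) : mulOp μ (star f) = star (mulOp μ f) := by
  rw [ContinuousLinearMap.star_eq_adjoint, ContinuousLinearMap.eq_adjoint_iff]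
  intro u v
  rw [L2.inner_def, L2.inner_def]
  apply integral_congr_ae
  filter_upwards [coeFn_mulOp μ (star f) u, coeFn_mulOp μ f v] with x h1 h2
  rw [h1, h2]
  simp only [RCLike.inner_apply, ContinuousMap.star_apply, map_mul, RCLike.star_def,
    RCLike.conj_conj]
  ring

/-- The representation of the continuous functions by multiplication operators on `L²`. -/
def mulHom : C(X, ℂ) →⋆ₐ[ℂ] (Lp ℂ 2 μ →L[ℂ] Lp ℂ 2 μ) where
  toFun := mulOp μ
  map_one' := mulOp_one μ
  map_mul' := mulOp_mul μ
  map_zero' := by simp [mulOp]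
  map_add' f g := by simp [mulOp]
  commutes' c := by
    rw [Algebra.algebraMap_eq_smul_one, Algebra.algebraMap_eq_smul_one, ← mulOp_one μ]
    simp [mulOp]
  map_star' := mulOp_star μ

/-- Applying the operator to the constant `1` recovers `f` as an element of `L²`; a continuous
function that is zero almost everywhere vanishes, since open sets are charged. -/
theorem mulHom_injective [μ.IsOpenPosMeasure] : Function.Injective (mulHom μ) := by
  rw [injective_iff_map_eq_zero]
  intro f hf
  apply ContinuousMap.toLp_injective (p := 2) (𝕜 := ℂ) μ
  rw [map_zero]
  have h : mulHom μ f (ContinuousMap.toLp 2 μ ℂ 1) = ContinuousMap.toLp 2 μ ℂ f := by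
    apply Lp.ext
    filter_upwards [coeFn_mulOp μ f (ContinuousMap.toLp 2 μ ℂ 1),
      ContinuousMap.coeFn_toLp (p := 2) (𝕜 := ℂ) μ f,
      ContinuousMap.coeFn_toLp (p := 2) (𝕜 := ℂ) μ (1 : C(X, ℂ))] with x h1 h2 h3
    refine h1.trans ?_
    rw [h2, h3, ContinuousMap.one_apply, mul_one]
  rw [← h, hf, zero_apply]

end Multiplication

/-- The measure on the circle `ℝ / ℤ` for which the monomials are a Hilbert basis. -/
local instance : MeasureSpace UnitAddCircle := ⟨AddCircle.haarAddCircle⟩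

local instance : Measure.IsAddHaarMeasure (volume : Measure UnitAddCircle) :=
  inferInstanceAs (Measure.IsAddHaarMeasure AddCircle.haarAddCircle)

local instance : IsProbabilityMeasure (volume : Measure UnitAddCircle) :=
  inferInstanceAs (IsProbabilityMeasure AddCircle.haarAddCircle)

/-- The Fourier transform of the multiplication operators: the continuous functional calculus of
the commuting translations of `ℓ²(ℤᵈ)`. -/
def symbolHom (d : ℕ) : C(UnitAddTorus (Fin d), ℂ) →⋆ₐ[ℂ] (L2 d →L[ℂ] L2 d) :=
  (mFourierBasis (d := Fin d)).repr.conjStarAlgEquiv.toStarAlgHom.comp (mulHom volume)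

theorem symbolHom_injective (d : ℕ) : Function.Injective (symbolHom d) :=
  (mFourierBasis (d := Fin d)).repr.conjStarAlgEquiv.injective.comp (mulHom_injective volume)

/-- Multiplying by a monomial translates the Fourier coefficients. -/
theorem symbolHom_mFourier {d : ℕ} (v : Fin d → ℤ) :
    symbolHom d (mFourier v) = (shift v).toContinuousLinearMap := by
  ext u n
  obtain ⟨x, rfl⟩ := (mFourierBasis (d := Fin d)).repr.surjective u
  have h : symbolHom d (mFourier v) (mFourierBasis.repr x) =
      mFourierBasis.repr (mulOp volume (mFourier v) x) := by
    change mFourierBasis.repr (mulOp volume (mFourier v)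
      (mFourierBasis.repr.symm (mFourierBasis.repr x))) = _
    rw [LinearIsometryEquiv.symm_apply_apply]
  rw [h, mFourierBasis_repr]
  change _ = mFourierBasis.repr x (n - v)
  rw [mFourierBasis_repr]
  apply integral_congr_ae
  filter_upwards [coeFn_mulOp volume (mFourier v) x] with t ht
  rw [ht, smul_eq_mul, smul_eq_mul, ← mul_assoc, ← mFourier_add, neg_sub, sub_eq_neg_add]

/-- The real part of the monomial with exponent `v`, i.e. `x ↦ cos (2 π ⟨v, x⟩)`. -/
def cosSymbol {d : ℕ} (v : Fin d → ℤ) : C(UnitAddTorus (Fin d), ℝ) :=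
  ⟨fun x => (mFourier v x).re, by fun_prop⟩

theorem realSymbol_cosSymbol {d : ℕ} (v : Fin d → ℤ) :
    realSymbol (cosSymbol v) = (1 / 2 : ℂ) • (mFourier v + mFourier (-v)) := by
  ext x
  rw [realSymbol_apply, ContinuousMap.smul_apply, ContinuousMap.add_apply, mFourier_neg,
    smul_eq_mul]
  change (((mFourier v x).re : ℝ) : ℂ) = _
  rw [Complex.re_eq_add_conj]
  ring

theorem symbolHom_cosSymbol {d : ℕ} (v : Fin d → ℤ) :
    symbolHom d (realSymbol (cosSymbol v)) = (1 / 2 : ℂ) •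
      ((shift v).toContinuousLinearMap + (shift (-v)).toContinuousLinearMap) := by
  rw [realSymbol_cosSymbol, map_smul, map_add, symbolHom_mFourier, symbolHom_mFourier]

theorem symbolHom_cosSymbol_apply {d : ℕ} (v : Fin d → ℤ) (u : L2 d) (n : Fin d → ℤ) :
    symbolHom d (realSymbol (cosSymbol v)) u n = 1 / 2 * (u (n - v) + u (n + v)) := by
  rw [symbolHom_cosSymbol]
  change 1 / 2 * (u (n - v) + u (n - -v)) = _
  rw [sub_neg_eq_add]

/-- The symbol `∑ⱼ cos ξⱼ` of the Laplacian. -/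
def laplacianSymbol (d : ℕ) : C(UnitAddTorus (Fin d), ℝ) :=
  ∑ j : Fin d, cosSymbol (Pi.single j 1)

/-- The symbol `∑ⱼ sin ξⱼ sin κ ξⱼ` of the commutator of the Laplacian with the conjugate
operator. -/
def commSymbol (d κ : ℕ) : C(UnitAddTorus (Fin d), ℝ) :=
  ∑ j : Fin d, (1 / 2 : ℝ) •
    (cosSymbol (Pi.single j ((κ : ℤ) - 1)) - cosSymbol (Pi.single j ((κ : ℤ) + 1)))

theorem realSymbol_sum {X ι : Type*} [TopologicalSpace X] (s : Finset ι) (f : ι → C(X, ℝ)) :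
    realSymbol (∑ i ∈ s, f i) = ∑ i ∈ s, realSymbol (f i) := by
  ext x
  simp [ContinuousMap.sum_apply]

theorem symbolHom_laplacianSymbol (d : ℕ) :
    symbolHom d (realSymbol (laplacianSymbol d)) = laplacian d := by
  rw [laplacianSymbol, realSymbol_sum, map_sum, laplacian]
  refine Finset.sum_congr rfl fun j _ => ?_
  have h : star (mFourier (Pi.single j 1 : Fin d → ℤ)) = mFourier (-Pi.single j 1) := by
    ext x
    exact mFourier_neg.symm
  rw [symbolHom_cosSymbol, rightShift, ← symbolHom_mFourier, ← ContinuousLinearMap.star_eq_adjoint,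
    ← map_star, h, symbolHom_mFourier, symbolHom_mFourier]

theorem laplacian_apply {d : ℕ} (u : L2 d) (n : Fin d → ℤ) :
    laplacian d u n = ∑ j, 1 / 2 * (u (n - Pi.single j 1) + u (n + Pi.single j 1)) := by
  rw [← symbolHom_laplacianSymbol, laplacianSymbol, realSymbol_sum, map_sum,
    sum_apply, lp.coeFn_sum, Finset.sum_apply]
  refine Finset.sum_congr rfl fun j _ => ?_
  rw [symbolHom_cosSymbol_apply]

theorem symbolHom_commSymbol_apply {d κ : ℕ} (u : L2 d) (n : Fin d → ℤ) :
    symbolHom d (realSymbol (commSymbol d κ)) u n =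
      ∑ j, 1 / 4 * (u (n - Pi.single j ((κ : ℤ) - 1)) + u (n + Pi.single j ((κ : ℤ) - 1)) -
        u (n - Pi.single j ((κ : ℤ) + 1)) - u (n + Pi.single j ((κ : ℤ) + 1))) := by
  rw [commSymbol, realSymbol_sum, map_sum, sum_apply, lp.coeFn_sum,
    Finset.sum_apply]
  refine Finset.sum_congr rfl fun j _ => ?_
  have h (f g : C(UnitAddTorus (Fin d), ℝ)) : realSymbol ((1 / 2 : ℝ) • (f - g)) =
      (1 / 2 : ℂ) • (realSymbol f - realSymbol g) := by
    ext x
    simp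
  rw [h, map_smul, map_sub, smul_apply, sub_apply, lp.coeFn_smul, Pi.smul_apply, lp.coeFn_sub,
    Pi.sub_apply, symbolHom_cosSymbol_apply, symbolHom_cosSymbol_apply, smul_eq_mul]
  ring

end LatticeMourre

end

/-! ### The commutator of the Laplacian with the conjugate operator -/

noncomputable section

namespace LatticeMourre

open Set

section Commutator

variable {H : Type*} [NormedAddCommGroup H] [InnerProductSpace ℂ H] {T C : H →L[ℂ] H}
  {A : H →ₗ.[ℂ] H}

/-- The identity is a closed condition on pairs of points of the graph, because `T` and `C` are
bounded; it therefore passes to the closure of the graph. -/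
theorem IsCommutator.closure (h : IsCommutator T A C) : IsCommutator T A.closure C := by
  by_cases hA : A.IsClosable
  swap
  -- A non-closable operator is its own closure by convention, so closability need not be shown.
  · rwa [LinearPMap.closure_def' hA]
  set Z : Set ((H × H) × (H × H)) := {p | inner ℂ p.1.1 (C p.2.1) =
    Complex.I * (inner ℂ (T p.1.1) p.2.2 - inner ℂ p.1.2 (T p.2.1))}
  have hZ : IsClosed Z := isClosed_eq (by fun_prop) (by fun_prop)
  have hsub : (A.graph : Set (H × H)) ×ˢ (A.graph : Set (H × H)) ⊆ Z := by
    rintro ⟨⟨a, b⟩, ⟨c, d⟩⟩ ⟨hp, hq⟩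
    obtain ⟨ψ, rfl, rfl⟩ := (LinearPMap.mem_graph_iff _).1 hp
    obtain ⟨φ, rfl, rfl⟩ := (LinearPMap.mem_graph_iff _).1 hq
    exact h ψ φ
  have hcl := closure_minimal hsub hZ
  rw [closure_prod_eq, ← Submodule.topologicalClosure_coe,
    hA.graph_closure_eq_closure_graph] at hcl
  exact fun ψ φ => @hcl ⟨(ψ, A.closure ψ), (φ, A.closure φ)⟩
    ⟨LinearPMap.mem_graph _ ψ, LinearPMap.mem_graph _ φ⟩

theorem IsCommutator.unique {C' : H →L[ℂ] H} (hA : Dense (A.domain : Set H))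
    (h : IsCommutator T A C) (h' : IsCommutator T A C') : C' = C := by
  refine DFunLike.coe_injective (Continuous.ext_on hA C'.continuous C.continuous fun φ hφ => ?_)
  refine hA.eq_of_inner_right ℂ fun ψ hψ => ?_
  exact (h' ⟨ψ, hψ⟩ ⟨φ, hφ⟩).trans (h ⟨ψ, hψ⟩ ⟨φ, hφ⟩).symm

theorem isCommutator_neg_iff : IsCommutator T (-A) C ↔ IsCommutator T A (-C) := by
  refine forall_congr' fun (ψ : A.domain) => forall_congr' fun (φ : A.domain) => ?_
  change inner ℂ (ψ : H) (C φ) =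
    Complex.I * (inner ℂ (T ψ) (-A φ) - inner ℂ (-A ψ) (T φ)) ↔
    inner ℂ (ψ : H) (-C φ) = Complex.I * (inner ℂ (T ψ) (A φ) - inner ℂ (A ψ) (T φ))
  rw [inner_neg_right, inner_neg_right, inner_neg_left, neg_eq_iff_eq_neg]
  ring_nf

end Commutator

variable {d : ℕ}

/-! ### Density of finitely supported sequences and symmetry of the operators -/

theorem dense_finSupp : Dense (finSupp d : Set (L2 d)) := by
  intro u
  refine mem_closure_of_tendsto (lp.hasSum_single (p := 2) (by norm_num) u)
    (Filter.Eventually.of_forall fun s => ?_)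
  refine (finSupp d).sum_mem fun i _ => ?_
  refine (Set.finite_singleton i).subset fun n hn => ?_
  by_contra hni
  exact hn (lp.single_apply_ne (E := fun _ : Fin d → ℤ => ℂ) 2 i (u i) fun h => hni h)

theorem shift_mem_finSupp (v : Fin d → ℤ) {u : L2 d} (hu : u ∈ finSupp d) :
    shift v u ∈ finSupp d :=
  Set.Finite.preimage (Equiv.subRight v).injective.injOn hu

theorem laplacian_mem_finSupp {u : L2 d} (hu : u ∈ finSupp d) : laplacian d u ∈ finSupp d := by
  rw [← symbolHom_laplacianSymbol, laplacianSymbol, realSymbol_sum, map_sum, sum_apply]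
  refine (finSupp d).sum_mem fun j _ => ?_
  rw [symbolHom_cosSymbol]
  exact (finSupp d).smul_mem _
    ((finSupp d).add_mem (shift_mem_finSupp _ hu) (shift_mem_finSupp _ hu))

theorem inner_laplacian_left (u v : L2 d) :
    inner ℂ (laplacian d u) v = inner ℂ u (laplacian d v) := by
  have h : IsSelfAdjoint (laplacian d) := by
    rw [← symbolHom_laplacianSymbol]
    exact (isSelfAdjoint_realSymbol _).map _
  conv_lhs => rw [← h.adjoint_eq]
  rw [ContinuousLinearMap.adjoint_inner_left]

theorem inner_shift_left (v : Fin d → ℤ) (u w : L2 d) :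
    inner ℂ (shift v u) w = inner ℂ u (shift (-v) w) := by
  rw [← (shift v).inner_map_map u]
  congr 1
  ext n
  simp

theorem inner_shiftFin_left (j : Fin d) (m : ℤ) (u w : finSupp d) :
    inner ℂ (shiftFin j m u) w = inner ℂ u (shiftFin j (-m) w) := by
  have h := inner_shift_left (Pi.single j m) u.1 w.1
  rw [← Pi.single_neg] at h
  exact h

theorem inner_positionFin_left (j : Fin d) (u w : finSupp d) :
    inner ℂ (positionFin j u) w = inner ℂ u (positionFin j w) := by
  change inner ℂ (positionFin j u).1 w.1 = inner ℂ u.1 (positionFin j w).1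
  rw [lp.inner_eq_tsum, lp.inner_eq_tsum]
  refine tsum_congr fun n => ?_
  change inner ℂ ((n j : ℂ) * u.1 n) (w.1 n) = inner ℂ (u.1 n) ((n j : ℂ) * w.1 n)
  simp only [RCLike.inner_apply, map_mul, map_intCast]
  ring

theorem inner_conjFin_left (k : ℕ) (j : Fin d) (u w : finSupp d) :
    inner ℂ (conjFin k j u) w = inner ℂ u (conjFin k j w) := by
  simp only [conjFin, LinearMap.smul_apply, LinearMap.add_apply, LinearMap.comp_apply,
    LinearMap.sub_apply, inner_smul_left, inner_smul_right, inner_add_left, inner_add_right,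
    inner_sub_left, inner_sub_right, map_sub, inner_shiftFin_left, inner_positionFin_left, neg_neg]
  -- The sign from conjugating `1 / (4i)` compensates the antisymmetry of `S_j ^ k - S_j ^ (-k)`.
  have h : (starRingEnd ℂ) (1 / (4 * Complex.I)) = -(1 / (4 * Complex.I)) := by
    rw [map_div₀, map_one, map_mul, map_ofNat, Complex.conj_I, mul_neg, div_neg]
  rw [h]
  ring

theorem shiftFin_apply (j : Fin d) (m : ℤ) (u : finSupp d) (n : Fin d → ℤ) :
    (shiftFin j m u).1 n = u.1 (n - Pi.single j m) := rfl

theorem positionFin_apply (j : Fin d) (u : finSupp d) (n : Fin d → ℤ) :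
    (positionFin j u).1 n = n j * u.1 n := rfl

theorem conjFin_apply (k : ℕ) (j : Fin d) (u : finSupp d) (n : Fin d → ℤ) :
    (conjFin k j u).1 n = 1 / (4 * Complex.I) * ((2 * n j - k) * u.1 (n - Pi.single j (k : ℤ)) -
      (2 * n j + k) * u.1 (n + Pi.single j (k : ℤ))) := by
  simp only [conjFin, LinearMap.smul_apply, LinearMap.add_apply, LinearMap.comp_apply,
    LinearMap.sub_apply, Submodule.coe_smul, Submodule.coe_add, Submodule.coe_sub, lp.coeFn_smul,
    lp.coeFn_add, lp.coeFn_sub, Pi.smul_apply, Pi.add_apply, Pi.sub_apply, shiftFin_apply,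
    positionFin_apply, Pi.single_neg, sub_neg_eq_add, Pi.neg_apply, Pi.single_eq_same, smul_eq_mul]
  push_cast
  ring

/-- Shifts in the other directions commute with `A_j`, so only the `j`-th term of the Laplacian
contributes. The weights of `A_j` are affine in `n_j`, so a unit shift changes them by a constant
and the dependence on position cancels. -/
theorem commutator_conjFin_apply (k : ℕ) (j : Fin d) (u : finSupp d) (n : Fin d → ℤ) :
    Complex.I * (laplacian d (conjFin k j u).1 n -
        (conjFin k j ⟨laplacian d u.1, laplacian_mem_finSupp u.2⟩).1 n) =
      1 / 4 * (u.1 (n - Pi.single j ((k : ℤ) - 1)) + u.1 (n + Pi.single j ((k : ℤ) - 1)) -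
        u.1 (n - Pi.single j ((k : ℤ) + 1)) - u.1 (n + Pi.single j ((k : ℤ) + 1))) := by
  rw [laplacian_apply, conjFin_apply, laplacian_apply, laplacian_apply, Finset.mul_sum,
    Finset.mul_sum, ← Finset.sum_sub_distrib, Finset.mul_sum, ← Finset.sum_sub_distrib,
    Finset.mul_sum, Finset.sum_eq_single j]
  · simp only [conjFin_apply, Pi.sub_apply, Pi.add_apply, Pi.single_eq_same, Pi.single_sub,
      Pi.single_add]
    have e1 : n - Pi.single j 1 - Pi.single j (k : ℤ) =
        n - (Pi.single j (k : ℤ) + Pi.single j 1) := by abel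
    have e2 : n - Pi.single j 1 + Pi.single j (k : ℤ) =
        n + (Pi.single j (k : ℤ) - Pi.single j 1) := by abel
    have e3 : n + Pi.single j 1 - Pi.single j (k : ℤ) =
        n - (Pi.single j (k : ℤ) - Pi.single j 1) := by abel
    have e4 : n + Pi.single j 1 + Pi.single j (k : ℤ) =
        n + (Pi.single j (k : ℤ) + Pi.single j 1) := by abel
    have e5 : n - Pi.single j (k : ℤ) - Pi.single j 1 =
        n - (Pi.single j (k : ℤ) + Pi.single j 1) := by abel
    have e6 : n - Pi.single j (k : ℤ) + Pi.single j 1 =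
        n - (Pi.single j (k : ℤ) - Pi.single j 1) := by abel
    have e7 : n + Pi.single j (k : ℤ) - Pi.single j 1 =
        n + (Pi.single j (k : ℤ) - Pi.single j 1) := by abel
    have e8 : n + Pi.single j (k : ℤ) + Pi.single j 1 =
        n + (Pi.single j (k : ℤ) + Pi.single j 1) := by abel
    rw [e1, e2, e3, e4, e5, e6, e7, e8]
    push_cast
    field_simp
    ring
  · intro i _ hij
    simp only [conjFin_apply, Pi.sub_apply, Pi.add_apply, Pi.single_eq_of_ne hij.symm, sub_zero,
      add_zero, sub_right_comm n (Pi.single j (k : ℤ)), add_right_comm n (Pi.single j (k : ℤ)),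
      sub_add_eq_add_sub n (Pi.single j (k : ℤ)), sub_add_eq_add_sub n (Pi.single i 1)]
    ring
  · simp

/-- The conjugate operator on finitely supported sequences, before taking the closure. -/
def conjCore (d κ : ℕ) : L2 d →ₗ.[ℂ] L2 d where
  domain := finSupp d
  toFun := (finSupp d).subtype ∘ₗ ∑ j : Fin d, conjFin κ j

theorem isCommutator_conjOp (κ : ℕ) :
    IsCommutator (laplacian d) (conjOp fun _ : Fin d => κ)
      (symbolHom d (realSymbol (commSymbol d κ))) := by
  refine IsCommutator.closure (A := conjCore d κ) ?_
  intro (ψ : finSupp d) (φ : finSupp d)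
  set B : finSupp d →ₗ[ℂ] finSupp d := ∑ j : Fin d, conjFin κ j
  have hB : inner ℂ (B ψ) ⟨laplacian d φ.1, laplacian_mem_finSupp φ.2⟩ =
      inner ℂ ψ (B ⟨laplacian d φ.1, laplacian_mem_finSupp φ.2⟩) := by
    simp only [B, LinearMap.sum_apply, sum_inner, inner_sum, inner_conjFin_left]
  change inner ℂ ψ.1 _ = Complex.I * (inner ℂ (laplacian d ψ.1) (B φ).1 -
    inner ℂ (B ψ) (⟨laplacian d φ.1, laplacian_mem_finSupp φ.2⟩ : finSupp d))
  rw [hB, inner_laplacian_left]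
  change _ = Complex.I * (inner ℂ ψ.1 (laplacian d (B φ).1) - inner ℂ ψ.1 (B _).1)
  rw [← inner_sub_right, ← inner_smul_right]
  congr 1
  ext n
  rw [symbolHom_commSymbol_apply, lp.coeFn_smul, Pi.smul_apply, lp.coeFn_sub, Pi.sub_apply,
    smul_eq_mul]
  simp only [← commutator_conjFin_apply]
  simp only [B, LinearMap.sum_apply, Submodule.coe_sum, map_sum, lp.coeFn_sum, Finset.sum_apply,
    ← Finset.sum_sub_distrib, Finset.mul_sum]

theorem isCommutator_conjOp_iff (κ : ℕ) (C : L2 d →L[ℂ] L2 d) :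
    IsCommutator (laplacian d) (conjOp fun _ : Fin d => κ) C ↔
      C = symbolHom d (realSymbol (commSymbol d κ)) := by
  constructor
  · refine (isCommutator_conjOp κ).unique (dense_finSupp.mono ?_)
    exact (LinearPMap.le_closure (conjCore d κ)).1
  · rintro rfl
    exact isCommutator_conjOp κ

theorem isCommutator_neg_conjOp_iff (κ : ℕ) (C : L2 d →L[ℂ] L2 d) :
    IsCommutator (laplacian d) (-conjOp fun _ : Fin d => κ) C ↔
      C = symbolHom d (realSymbol (-commSymbol d κ)) := by
  have h : realSymbol (-commSymbol d κ) = -realSymbol (commSymbol d κ) := by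
    ext x
    simp
  rw [isCommutator_neg_iff, isCommutator_conjOp_iff, h, map_neg, neg_eq_iff_eq_neg]

/-! ### The Mourre sets in terms of the symbols -/

/-- The Chebyshev form `sin ξ sin κ ξ` of one coordinate of the symbol of the commutator, as a
function of `cos ξ`. -/
def commPoly (κ : ℕ) (c : ℝ) : ℝ :=
  1 / 2 * ((Polynomial.Chebyshev.T ℝ ((κ : ℤ) - 1)).eval c -
    (Polynomial.Chebyshev.T ℝ ((κ : ℤ) + 1)).eval c)

theorem cosSymbol_single_apply (j : Fin d) (m : ℤ) (t : Fin d → ℝ) :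
    cosSymbol (Pi.single j m) (fun i => (t i : UnitAddCircle)) =
      Real.cos (m * (2 * Real.pi * t j)) := by
  have h : UnitAddTorus.mFourier (Pi.single j m) (fun i => (t i : UnitAddCircle)) =
      fourier m (t j : UnitAddCircle) := by
    rw [UnitAddTorus.mFourier, ContinuousMap.coe_mk, Finset.prod_eq_single j]
    · rw [Pi.single_eq_same]
    · intro i _ hij
      rw [Pi.single_eq_of_ne hij, fourier_zero]
    · simp
  change (UnitAddTorus.mFourier (Pi.single j m) (fun i => (t i : UnitAddCircle))).re = _
  rw [h, fourier_coe_apply, ← Complex.exp_ofReal_mul_I_re]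
  congr 2
  push_cast
  ring

theorem laplacianSymbol_apply (t : Fin d → ℝ) :
    laplacianSymbol d (fun i => (t i : UnitAddCircle)) = ∑ j, Real.cos (2 * Real.pi * t j) := by
  simp [laplacianSymbol, ContinuousMap.sum_apply, cosSymbol_single_apply]

theorem commSymbol_apply (κ : ℕ) (t : Fin d → ℝ) :
    commSymbol d κ (fun i => (t i : UnitAddCircle)) =
      ∑ j, commPoly κ (Real.cos (2 * Real.pi * t j)) := by
  simp only [commSymbol, commPoly, ContinuousMap.sum_apply, ContinuousMap.smul_apply,
    ContinuousMap.sub_apply, cosSymbol_single_apply, smul_eq_mul,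
    Polynomial.Chebyshev.T_real_cos]

/-- The cosines of the angles fill the whole cube, and both symbols depend on the angles only
through them. -/
theorem exists_symbol_iff (κ : ℕ) (P : ℝ → ℝ → Prop) :
    (∃ x, P (laplacianSymbol d x) (commSymbol d κ x)) ↔
      ∃ c : Fin d → ℝ, (∀ j, c j ∈ Icc (-1) 1) ∧ P (∑ j, c j) (∑ j, commPoly κ (c j)) := by
  constructor
  · rintro ⟨x, hx⟩
    obtain ⟨t, rfl⟩ : ∃ t : Fin d → ℝ, (fun i => (t i : UnitAddCircle)) = x :=
      ⟨fun i => (x i).out, funext fun i => QuotientAddGroup.out_eq' (x i)⟩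
    refine ⟨fun j => Real.cos (2 * Real.pi * t j), fun j => ?_, ?_⟩
    · exact ⟨Real.neg_one_le_cos _, Real.cos_le_one _⟩
    · rwa [laplacianSymbol_apply, commSymbol_apply] at hx
  · rintro ⟨c, hc, h⟩
    refine ⟨fun i => ((Real.arccos (c i) / (2 * Real.pi) : ℝ) : UnitAddCircle), ?_⟩
    have hcos (j : Fin d) : Real.cos (2 * Real.pi * (Real.arccos (c j) / (2 * Real.pi))) = c j := by
      rw [mul_div_cancel₀ _ Real.two_pi_pos.ne', Real.cos_arccos (hc j).1 (hc j).2]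
    rw [laplacianSymbol_apply, commSymbol_apply]
    simpa only [hcos] using h

/-- `E` is in the Mourre set if and only if the symbol of the commutator has a strict constant sign
on the constant energy surface `∑ⱼ cos ξⱼ = E`. -/
theorem mem_muLaplacian_iff (d κ : ℕ) (E : ℝ) :
    E ∈ muLaplacian d κ ↔ |E| ≤ d ∧
      ((∀ c : Fin d → ℝ, (∀ j, c j ∈ Icc (-1) 1) → ∑ j, c j = E → 0 < ∑ j, commPoly κ (c j)) ∨
       (∀ c : Fin d → ℝ, (∀ j, c j ∈ Icc (-1) 1) → ∑ j, c j = E → ∑ j, commPoly κ (c j) < 0)) := by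
  have hrange : E ∈ range (laplacianSymbol d) ↔ |E| ≤ d := by
    rw [mem_range, exists_symbol_iff 0 fun e _ => e = E]
    constructor
    · rintro ⟨c, hc, rfl⟩
      refine (Finset.abs_sum_le_sum_abs _ _).trans ?_
      simpa using Finset.sum_le_card_nsmul Finset.univ (fun j => |c j|) 1
        (fun j _ => abs_le.2 (hc j))
    · intro h
      rcases Nat.eq_zero_or_pos d with rfl | hd
      · exact ⟨0, fun j => j.elim0, by simpa using (abs_nonpos_iff.1 (by simpa using h)).symm⟩
      · have hd' : (0 : ℝ) < d := Nat.cast_pos.2 hd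
        refine ⟨fun _ => E / d, fun _ => abs_le.1 ?_, ?_⟩
        · rwa [abs_div, abs_of_pos hd', div_le_one hd']
        · simp [mul_div_cancel₀ E hd'.ne']
  have hall (s : ℝ) : (∀ x, laplacianSymbol d x = E → 0 < s * commSymbol d κ x) ↔
      ∀ c : Fin d → ℝ, (∀ j, c j ∈ Icc (-1) 1) → ∑ j, c j = E →
        0 < s * ∑ j, commPoly κ (c j) := by
    have h := exists_symbol_iff (d := d) κ fun e g => e = E ∧ ¬ 0 < s * g
    rw [← not_iff_not]
    push Not at h ⊢
    exact h
  have h1 := mem_mourreSetPos_iff (symbolHom d) (symbolHom_injective d) (laplacianSymbol d)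
    (commSymbol d κ) (conjOp fun _ : Fin d => κ)
    (by rw [symbolHom_laplacianSymbol]; exact isCommutator_conjOp_iff κ) E
  have h2 := mem_mourreSetPos_iff (symbolHom d) (symbolHom_injective d) (laplacianSymbol d)
    (-commSymbol d κ) (-conjOp fun _ : Fin d => κ)
    (by rw [symbolHom_laplacianSymbol]; exact isCommutator_neg_conjOp_iff κ) E
  rw [symbolHom_laplacianSymbol, hrange] at h1 h2
  have h3 := hall 1
  have h4 := hall (-1)
  simp only [one_mul, neg_mul, Left.neg_pos_iff] at h3 h4
  simp only [ContinuousMap.neg_apply, Left.neg_pos_iff] at h2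
  rw [muLaplacian, mourreSet, mem_union, h1, h2, h3, h4, ← and_or_left]

end LatticeMourre

end

/-! ### The bands -/

namespace LatticeMourre

open Set

theorem commPoly_two (c : ℝ) : commPoly 2 c = 2 * c * (1 - c ^ 2) := by
  have h : Polynomial.Chebyshev.T ℝ 3 = 2 * Polynomial.X * Polynomial.Chebyshev.T ℝ 2 -
    Polynomial.Chebyshev.T ℝ 1 := Polynomial.Chebyshev.T_add_two ℝ 1
  norm_num [commPoly, h, Polynomial.Chebyshev.T_two]
  ring

theorem commPoly_three (c : ℝ) : commPoly 3 c = (1 - c ^ 2) * (4 * c ^ 2 - 1) := by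
  have h : Polynomial.Chebyshev.T ℝ 3 = 2 * Polynomial.X * Polynomial.Chebyshev.T ℝ 2 -
    Polynomial.Chebyshev.T ℝ 1 := Polynomial.Chebyshev.T_add_two ℝ 1
  have h' : Polynomial.Chebyshev.T ℝ 4 = 2 * Polynomial.X * Polynomial.Chebyshev.T ℝ 3 -
    Polynomial.Chebyshev.T ℝ 2 := Polynomial.Chebyshev.T_add_two ℝ 2
  norm_num [commPoly, h, h', Polynomial.Chebyshev.T_two]
  ring

theorem commPoly_four (c : ℝ) : commPoly 4 c = 4 * c * (1 - c ^ 2) * (2 * c ^ 2 - 1) := by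
  have h : Polynomial.Chebyshev.T ℝ 3 = 2 * Polynomial.X * Polynomial.Chebyshev.T ℝ 2 -
    Polynomial.Chebyshev.T ℝ 1 := Polynomial.Chebyshev.T_add_two ℝ 1
  have h' : Polynomial.Chebyshev.T ℝ 4 = 2 * Polynomial.X * Polynomial.Chebyshev.T ℝ 3 -
    Polynomial.Chebyshev.T ℝ 2 := Polynomial.Chebyshev.T_add_two ℝ 2
  have h'' : Polynomial.Chebyshev.T ℝ 5 = 2 * Polynomial.X * Polynomial.Chebyshev.T ℝ 4 -
    Polynomial.Chebyshev.T ℝ 3 := Polynomial.Chebyshev.T_add_two ℝ 3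
  norm_num [commPoly, h, h', h'', Polynomial.Chebyshev.T_two]
  ring

theorem commPoly_one_right (κ : ℕ) : commPoly κ 1 = 0 := by
  simp [commPoly]

/-- The Chebyshev degrees `κ - 1` and `κ + 1` have the same parity. -/
theorem commPoly_neg (κ : ℕ) :
    (∀ c, commPoly κ (-c) = commPoly κ c) ∨ ∀ c, commPoly κ (-c) = -commPoly κ c := by
  have h (c : ℝ) : commPoly κ (-c) = ((((κ : ℤ) + 1).negOnePow : ℤ) : ℝ) * commPoly κ c := by
    have h1 : ((κ : ℤ) - 1).negOnePow = ((κ : ℤ) + 1).negOnePow := by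
      rw [Int.negOnePow_eq_iff]
      exact ⟨-1, by ring⟩
    simp only [commPoly, Polynomial.Chebyshev.T_eval_neg, h1]
    ring
  rcases Int.even_or_odd ((κ : ℤ) + 1) with hk | hk
  · exact .inl fun c => by simp [h, Int.negOnePow_even _ hk]
  · exact .inr fun c => by simp [h, Int.negOnePow_odd _ hk]

/-- The reflection `c ↦ -c` exchanges the slices of `E` and `-E`. It preserves the sign when
`commPoly κ` is even and reverses it when odd, which swaps the two alternatives. -/
theorem neg_mem_muLaplacian {d κ : ℕ} {E : ℝ} (hE : E ∈ muLaplacian d κ) :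
    -E ∈ muLaplacian d κ := by
  rw [mem_muLaplacian_iff] at hE ⊢
  rw [abs_neg]
  refine ⟨hE.1, ?_⟩
  have hflip {P : ℝ → Prop}
      (h : ∀ c : Fin d → ℝ, (∀ j, c j ∈ Icc (-1) 1) → ∑ j, c j = E → P (∑ j, commPoly κ (c j)))
      (c : Fin d → ℝ) (hc : ∀ j, c j ∈ Icc (-1) 1) (hs : ∑ j, c j = -E) :
      P (∑ j, commPoly κ (-c j)) :=
    h (fun j => -c j) (fun j => ⟨neg_le_neg (hc j).2, neg_le.1 (hc j).1⟩)
      (by rw [Finset.sum_neg_distrib, hs, neg_neg])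
  rcases commPoly_neg κ with hκ | hκ
  · rcases hE.2 with h | h
    · exact .inl fun c hc hs => by simpa only [hκ] using hflip h c hc hs
    · exact .inr fun c hc hs => by simpa only [hκ] using hflip (P := (· < 0)) h c hc hs
  · rcases hE.2 with h | h
    · refine .inr fun c hc hs => ?_
      have := hflip h c hc hs
      simp only [hκ, Finset.sum_neg_distrib] at this
      linarith
    · refine .inl fun c hc hs => ?_
      have := hflip (P := (· < 0)) h c hc hs
      simp only [hκ, Finset.sum_neg_distrib] at this
      linarith

theorem notMem_muLaplacian {d κ : ℕ} {E : ℝ} (c c' : Fin d → ℝ) (hc : ∀ j, c j ∈ Icc (-1) 1)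
    (hs : ∑ j, c j = E) (h : 0 ≤ ∑ j, commPoly κ (c j)) (hc' : ∀ j, c' j ∈ Icc (-1) 1)
    (hs' : ∑ j, c' j = E) (h' : ∑ j, commPoly κ (c' j) ≤ 0) : E ∉ muLaplacian d κ := by
  rw [mem_muLaplacian_iff]
  rintro ⟨-, h1 | h1⟩
  · exact absurd (h1 c' hc' hs') (not_lt.2 h')
  · exact absurd (h1 c hc hs) (not_lt.2 h)

theorem natCast_notMem_muLaplacian (d κ : ℕ) : (d : ℝ) ∉ muLaplacian d κ :=
  notMem_muLaplacian 1 1 (by simp) (by simp) (by simp [commPoly_one_right]) (by simp) (by simp)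
    (by simp [commPoly_one_right])

/-- The band of energies above the one at which a coordinate can reach the last zero `a < 1` of
`commPoly κ`. -/
theorem mem_muLaplacian_of_top_band {d κ : ℕ} {a E : ℝ}
    (hp : ∀ x, a < x → x < 1 → 0 < commPoly κ x) (hE : (d : ℝ) - 1 + a < E) (hE' : E < d)
    (hE0 : 0 ≤ E) : E ∈ muLaplacian d κ := by
  rw [mem_muLaplacian_iff, abs_of_nonneg hE0]
  refine ⟨hE'.le, .inl fun c hc hs => ?_⟩
  have hca (j : Fin d) : a < c j := by
    -- The other `d - 1` coordinates sum to at most `d - 1`, which forces `c j > a`.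
    have h1 := Finset.add_sum_erase Finset.univ c (Finset.mem_univ j)
    have h2 : ∑ i ∈ Finset.univ.erase j, c i ≤ (d : ℝ) - 1 := by
      have h3 := Finset.sum_le_card_nsmul (Finset.univ.erase j) c 1 (fun i _ => (hc i).2)
      rwa [Finset.card_erase_of_mem (Finset.mem_univ j), Finset.card_univ, Fintype.card_fin,
        nsmul_eq_mul, mul_one, Nat.cast_pred j.pos] at h3
    linarith
  -- Strictness comes from `E < d`: not all coordinates equal `1`, where `commPoly κ` vanishes.
  obtain ⟨j, -, hj⟩ : ∃ j ∈ Finset.univ, c j < 1 := by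
    apply Finset.exists_lt_of_sum_lt
    simpa [hs] using hE'
  refine Finset.sum_pos' (fun i _ => ?_) ⟨j, Finset.mem_univ j, hp _ (hca j) hj⟩
  rcases (hc i).2.lt_or_eq with h | h
  · exact (hp _ (hca i) h).le
  · rw [h, commPoly_one_right]

theorem mem_muLaplacian_two_of_neg {κ : ℕ} {E : ℝ} (hE : |E| ≤ 2)
    (h : ∀ x y : ℝ, x + y = E → commPoly κ x + commPoly κ y < 0) : E ∈ muLaplacian 2 κ := by
  rw [mem_muLaplacian_iff]
  refine ⟨hE, .inr fun c _ hs => ?_⟩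
  rw [Fin.sum_univ_two] at hs ⊢
  exact h _ _ hs

theorem mem_muLaplacian_one_iff {κ : ℕ} {E : ℝ} :
    E ∈ muLaplacian 1 κ ↔ |E| ≤ 1 ∧ commPoly κ E ≠ 0 := by
  rw [mem_muLaplacian_iff, Nat.cast_one]
  refine and_congr_right fun hE => ?_
  rw [ne_comm, ne_iff_lt_or_gt]
  have hmem (j : Fin 1) : (fun _ : Fin 1 => E) j ∈ Icc (-1 : ℝ) 1 := abs_le.1 hE
  refine or_congr ⟨fun h => ?_, fun h c _ hs => ?_⟩ ⟨fun h => ?_, fun h c _ hs => ?_⟩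
  · simpa using h _ hmem (by simp)
  · rw [Fin.sum_univ_one] at hs ⊢
    rwa [hs]
  · simpa using h _ hmem (by simp)
  · rw [Fin.sum_univ_one] at hs ⊢
    rwa [hs]

theorem notMem_muLaplacian_two {κ : ℕ} {E : ℝ} (x y x' y' : ℝ) (hx : |x| ≤ 1) (hy : |y| ≤ 1)
    (hs : x + y = E) (h : 0 ≤ commPoly κ x + commPoly κ y) (hx' : |x'| ≤ 1) (hy' : |y'| ≤ 1)
    (hs' : x' + y' = E) (h' : commPoly κ x' + commPoly κ y' ≤ 0) : E ∉ muLaplacian 2 κ :=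
  notMem_muLaplacian ![x, y] ![x', y'] (by simpa [Fin.forall_fin_two] using ⟨abs_le.1 hx, abs_le.1 hy⟩)
    (by simpa using hs) (by simpa using h)
    (by simpa [Fin.forall_fin_two] using ⟨abs_le.1 hx', abs_le.1 hy'⟩)
    (by simpa using hs') (by simpa using h')

theorem notMem_muLaplacian_three {κ : ℕ} {E : ℝ} (x y z x' y' z' : ℝ) (hx : |x| ≤ 1)
    (hy : |y| ≤ 1) (hz : |z| ≤ 1) (hs : x + y + z = E)
    (h : 0 ≤ commPoly κ x + commPoly κ y + commPoly κ z) (hx' : |x'| ≤ 1) (hy' : |y'| ≤ 1)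
    (hz' : |z'| ≤ 1) (hs' : x' + y' + z' = E)
    (h' : commPoly κ x' + commPoly κ y' + commPoly κ z' ≤ 0) : E ∉ muLaplacian 3 κ :=
  notMem_muLaplacian ![x, y, z] ![x', y', z']
    (by simpa [Fin.forall_fin_succ] using ⟨abs_le.1 hx, abs_le.1 hy, abs_le.1 hz⟩)
    (by simpa [Fin.sum_univ_three] using hs) (by simpa [Fin.sum_univ_three] using h)
    (by simpa [Fin.forall_fin_succ] using ⟨abs_le.1 hx', abs_le.1 hy', abs_le.1 hz'⟩)
    (by simpa [Fin.sum_univ_three] using hs') (by simpa [Fin.sum_univ_three] using h')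

/-! #### Signs of the Chebyshev forms -/

theorem commPoly_two_pos {x : ℝ} (h0 : 0 < x) (h1 : x < 1) : 0 < commPoly 2 x := by
  rw [commPoly_two]
  exact mul_pos (by linarith) (by nlinarith)

theorem commPoly_two_nonneg {x : ℝ} (h0 : 0 ≤ x) (h1 : x ≤ 1) : 0 ≤ commPoly 2 x := by
  rw [commPoly_two]
  exact mul_nonneg (by linarith) (by nlinarith)

theorem commPoly_two_nonpos {x : ℝ} (h0 : -1 ≤ x) (h1 : x ≤ 0) : commPoly 2 x ≤ 0 := by
  rw [commPoly_two]
  exact mul_nonpos_of_nonpos_of_nonneg (by linarith) (by nlinarith)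

theorem commPoly_three_pos {x : ℝ} (h0 : 1 / 2 < x) (h1 : x < 1) : 0 < commPoly 3 x := by
  rw [commPoly_three]
  exact mul_pos (by nlinarith) (by nlinarith)

theorem commPoly_three_nonneg {x : ℝ} (h0 : 1 / 2 ≤ x) (h1 : x ≤ 1) : 0 ≤ commPoly 3 x := by
  rw [commPoly_three]
  exact mul_nonneg (by nlinarith) (by nlinarith)

theorem commPoly_three_nonpos {x : ℝ} (h0 : -(1 / 2) ≤ x) (h1 : x ≤ 1 / 2) :
    commPoly 3 x ≤ 0 := by
  rw [commPoly_three]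
  exact mul_nonpos_of_nonneg_of_nonpos (by nlinarith) (by nlinarith)

theorem neg_one_le_commPoly_three {x : ℝ} (h : |x| ≤ 1) : -1 ≤ commPoly 3 x := by
  have h2 : x ^ 2 ≤ 1 := (sq_le_one_iff_abs_le_one x).2 h
  rw [commPoly_three]
  nlinarith [mul_nonneg (sq_nonneg x) (show 0 ≤ 5 - 4 * x ^ 2 by linarith)]

theorem commPoly_four_pos {x : ℝ} (h0 : 0 < x) (h : 1 / 2 < x ^ 2) (h1 : x < 1) :
    0 < commPoly 4 x := by
  rw [commPoly_four]
  exact mul_pos (mul_pos (by linarith) (by nlinarith)) (by linarith)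

theorem commPoly_four_nonneg {x : ℝ} (h0 : 0 ≤ x) (h : 1 / 2 ≤ x ^ 2) (h1 : x ≤ 1) :
    0 ≤ commPoly 4 x := by
  rw [commPoly_four]
  exact mul_nonneg (mul_nonneg (by linarith) (by nlinarith)) (by linarith)

theorem commPoly_four_nonpos {x : ℝ} (h0 : 0 ≤ x) (h : x ^ 2 ≤ 1 / 2) : commPoly 4 x ≤ 0 := by
  rw [commPoly_four]
  exact mul_nonpos_of_nonneg_of_nonpos (mul_nonneg (by linarith) (by nlinarith)) (by linarith)

/-- The form is `sin ξ sin 4ξ`; its square is `(1 - x²)(1 - T₄(x)²)` with `T₄ = 8x⁴ - 8x² + 1`. -/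
theorem neg_one_le_commPoly_four {x : ℝ} (h : |x| ≤ 1) : -1 ≤ commPoly 4 x := by
  have h2 : x ^ 2 ≤ 1 := (sq_le_one_iff_abs_le_one x).2 h
  have h3 : commPoly 4 x ^ 2 = (1 - x ^ 2) * (1 - (8 * x ^ 4 - 8 * x ^ 2 + 1) ^ 2) := by
    rw [commPoly_four]
    ring
  have h4 : commPoly 4 x ^ 2 ≤ 1 := by
    rw [h3]
    nlinarith [sq_nonneg x, sq_nonneg (8 * x ^ 4 - 8 * x ^ 2 + 1),
      mul_nonneg (sub_nonneg.2 h2) (sq_nonneg (8 * x ^ 4 - 8 * x ^ 2 + 1))]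
  exact (abs_le.1 ((sq_le_one_iff_abs_le_one _).1 h4)).1

/-! #### The two-dimensional constant energy curves -/

/-- Completing the square in `xy` at fixed sum. With `s = (x + y)²` the maximum `4s² - 5s + 9/8` has
roots `(5 ± √7) / 8`, whence the band edge. -/
theorem commPoly_three_add (x y : ℝ) : commPoly 3 x + commPoly 3 y =
    -8 * (x * y - ((x + y) ^ 2 - 5 / 8)) ^ 2 + 4 * (x + y) ^ 4 - 5 * (x + y) ^ 2 + 9 / 8 := by
  rw [commPoly_three, commPoly_three]
  ring

/-- The same square completion; the maximum of the second factor, `s² / 2 - 3s / 2 + 41 / 40`, has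
roots `3/2 ± 1/√5`. -/
theorem commPoly_four_add (x y : ℝ) : commPoly 4 x + commPoly 4 y =
    4 * (x + y) * (-10 * (x * y - ((x + y) ^ 2 / 2 - 9 / 20)) ^ 2 +
      (x + y) ^ 4 / 2 - 3 / 2 * (x + y) ^ 2 + 41 / 40) := by
  rw [commPoly_four, commPoly_four]
  ring

theorem commPoly_three_add_neg {x y : ℝ} (h1 : (5 - √7) / 8 < (x + y) ^ 2)
    (h2 : (x + y) ^ 2 < 1) : commPoly 3 x + commPoly 3 y < 0 := by
  have hp : x * y ≤ (x + y) ^ 2 / 4 := by nlinarith [sq_nonneg (x - y)]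
  have e4 : (x + y) ^ 4 = ((x + y) ^ 2) ^ 2 := by ring
  rw [commPoly_three_add, e4]
  generalize (x + y) ^ 2 = s at *
  generalize x * y = p at *
  -- The vertex `p = s - 5/8` respects the constraint `p ≤ s / 4` exactly when `s ≤ 5/6`. Beyond
  -- that the maximum is at `p = s / 4`, i.e. `x = y`, with value `-(1 - s)(4 - s) / 2`.
  rcases le_total s (5 / 6) with hs | hs
  · have h7 : √7 ^ 2 = 7 := Real.sq_sqrt (by norm_num)
    have h7' : 2 < √7 := Real.lt_sqrt_of_sq_lt (by norm_num)
    have h := mul_pos (show 0 < s - (5 - √7) / 8 by linarith)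
      (show 0 < (5 + √7) / 8 - s by linarith)
    nlinarith [sq_nonneg (p - (s - 5 / 8))]
  · have h := mul_nonneg (show 0 ≤ s / 4 - p by linarith)
      (show 0 ≤ 14 * s - 10 - 8 * p by linarith)
    have h' := mul_pos (show 0 < 1 - s by linarith) (show 0 < 4 - s by linarith)
    nlinarith

theorem commPoly_four_add_neg {x y : ℝ} (h0 : 0 < x + y) (h1 : 3 / 2 - 1 / √5 < (x + y) ^ 2)
    (h2 : (x + y) ^ 2 < 2) : commPoly 4 x + commPoly 4 y < 0 := by
  have hp : x * y ≤ (x + y) ^ 2 / 4 := by nlinarith [sq_nonneg (x - y)]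
  have e4 : (x + y) ^ 4 = ((x + y) ^ 2) ^ 2 := by ring
  rw [commPoly_four_add, e4]
  refine mul_neg_of_pos_of_neg (by linarith) ?_
  generalize (x + y) ^ 2 = s at *
  generalize x * y = p at *
  -- Here the vertex `s / 2 - 9/20` meets the constraint `p ≤ s / 4` at `s = 9/5`; afterwards the
  -- diagonal `x = y` is extremal.
  rcases le_total s (9 / 5) with hs | hs
  · have h5 : (1 / √5) ^ 2 = 1 / 5 := by rw [div_pow, Real.sq_sqrt (by norm_num), one_pow]
    have h5' : 2 / 5 < 1 / √5 := lt_of_pow_lt_pow_left₀ 2 (by positivity) (by rw [h5]; norm_num)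
    have h := mul_pos (show 0 < s - (3 / 2 - 1 / √5) by linarith)
      (show 0 < (3 / 2 + 1 / √5) - s by linarith)
    nlinarith [sq_nonneg (p - (s / 2 - 9 / 20))]
  · have h := mul_nonneg (show 0 ≤ s / 4 - p by linarith)
      (show 0 ≤ 10 * s - 9 - 10 * (p + s / 4) by linarith)
    have h' := mul_pos (show 0 < 2 - s by linarith) (show 0 < 4 - s by linarith)
    nlinarith

theorem exists_commPoly_three_add_nonneg {E : ℝ} (h0 : 0 ≤ E) (h : E ^ 2 ≤ (5 - √7) / 8) :
    ∃ x y : ℝ, |x| ≤ 1 ∧ |y| ≤ 1 ∧ x + y = E ∧ 0 ≤ commPoly 3 x + commPoly 3 y := by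
  have h7 : √7 ^ 2 = 7 := Real.sq_sqrt (by norm_num)
  have h7' : 2 < √7 := Real.lt_sqrt_of_sq_lt (by norm_num)
  -- Chosen so that `(E/2 + r)(E/2 - r) = E² - 5/8`, the vertex of the quadratic.
  set r := √(5 / 8 - 3 / 4 * E ^ 2) with hr
  have hr0 : 0 ≤ r := Real.sqrt_nonneg _
  have hr2 : r ^ 2 = 5 / 8 - 3 / 4 * E ^ 2 := Real.sq_sqrt (by nlinarith)
  have hr1 : r ≤ 1 - E / 2 := by
    refine abs_le_of_sq_le_sq' ?_ ?_ |>.2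
    · rw [hr2]
      nlinarith [sq_nonneg (E - 1 / 2)]
    · nlinarith
  refine ⟨E / 2 + r, E / 2 - r, abs_le.2 ⟨by linarith, by linarith⟩,
    abs_le.2 ⟨by linarith, by linarith⟩, by ring, ?_⟩
  rw [commPoly_three_add]
  have e1 : (E / 2 + r) * (E / 2 - r) - ((E / 2 + r + (E / 2 - r)) ^ 2 - 5 / 8) = 0 := by
    linear_combination -hr2
  have e2 : E / 2 + r + (E / 2 - r) = E := by ring
  rw [e1, e2]
  nlinarith [mul_nonneg (show 0 ≤ (5 - √7) / 8 - E ^ 2 by linarith)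
      (show 0 ≤ (5 + √7) / 8 - E ^ 2 by linarith)]

theorem exists_commPoly_four_add_nonneg {E : ℝ} (h0 : 0 ≤ E) (h : E ^ 2 ≤ 3 / 2 - 1 / √5) :
    ∃ x y : ℝ, |x| ≤ 1 ∧ |y| ≤ 1 ∧ x + y = E ∧ 0 ≤ commPoly 4 x + commPoly 4 y := by
  have h5 : (1 / √5) ^ 2 = 1 / 5 := by rw [div_pow, Real.sq_sqrt (by norm_num), one_pow]
  have h5' : 0 < 1 / √5 := by positivity
  -- Again the product of the two coordinates is the vertex, now `E² / 2 - 9/20`.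
  set r := √(9 / 20 - 1 / 4 * E ^ 2) with hr
  have hr0 : 0 ≤ r := Real.sqrt_nonneg _
  have hr2 : r ^ 2 = 9 / 20 - 1 / 4 * E ^ 2 := Real.sq_sqrt (by nlinarith)
  have hr1 : r ≤ 1 - E / 2 := by
    refine abs_le_of_sq_le_sq' ?_ ?_ |>.2
    · rw [hr2]
      nlinarith [sq_nonneg (E - 1)]
    · nlinarith
  refine ⟨E / 2 + r, E / 2 - r, abs_le.2 ⟨by linarith, by linarith⟩,
    abs_le.2 ⟨by linarith, by linarith⟩, by ring, ?_⟩
  rw [commPoly_four_add]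
  have e1 : (E / 2 + r) * (E / 2 - r) - ((E / 2 + r + (E / 2 - r)) ^ 2 / 2 - 9 / 20) = 0 := by
    linear_combination -hr2
  have e2 : E / 2 + r + (E / 2 - r) = E := by ring
  rw [e1, e2]
  refine mul_nonneg (by linarith) ?_
  nlinarith [mul_nonneg (show 0 ≤ 3 / 2 - 1 / √5 - E ^ 2 by linarith)
      (show 0 ≤ 3 / 2 + 1 / √5 - E ^ 2 by linarith)]

end LatticeMourre

namespace LatticeMourre

open Set

/-! ### The theorem, dimension by dimension -/

theorem openBands_one_subset {κ : ℕ} (hκ : κ = 2 ∨ κ = 3 ∨ κ = 4) :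
    openBands 1 κ ⊆ muLaplacian 1 κ := by
  have hsq : (1 / √2) ^ 2 = 1 / 2 := by rw [div_pow, Real.sq_sqrt (by norm_num), one_pow]
  have hpos : 0 < 1 / √2 := by positivity
  rcases hκ with rfl | rfl | rfl <;> simp only [openBands] <;> intro E hE <;>
    rw [mem_muLaplacian_one_iff]
  · exact ⟨abs_le.2 ⟨by linarith [hE.1], hE.2.le⟩, (commPoly_two_pos hE.1 hE.2).ne'⟩
  · obtain ⟨⟨h0, h1⟩, h⟩ := hE
    refine ⟨abs_le.2 ⟨by linarith, h1.le⟩, ?_⟩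
    -- The factorisation isolates `E - 1/2`, the only factor that can vanish on `[0, 1)`.
    rw [commPoly_three, show (1 - E ^ 2) * (4 * E ^ 2 - 1) =
      (1 - E) * (1 + E) * (2 * E + 1) * (2 * (E - 1 / 2)) by ring]
    have h2 : E - 1 / 2 ≠ 0 := sub_ne_zero.2 h
    have h3 : 1 - E ≠ 0 := by linarith
    have h4 : 1 + E ≠ 0 := by linarith
    have h5 : 2 * E + 1 ≠ 0 := by linarith
    positivity
  · obtain ⟨⟨h0, h1⟩, h⟩ := hE
    refine ⟨abs_le.2 ⟨by linarith, h1.le⟩, ?_⟩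
    rw [commPoly_four, show 4 * E * (1 - E ^ 2) * (2 * E ^ 2 - 1) =
      4 * E * (1 - E) * (1 + E) * (E + 1 / √2) * (2 * (E - 1 / √2)) by
        linear_combination 4 * E * (1 - E ^ 2) * 2 * hsq]
    have h2 : E - 1 / √2 ≠ 0 := sub_ne_zero.2 h
    have h3 : 1 - E ≠ 0 := by linarith
    have h4 : 1 + E ≠ 0 := by linarith
    have h5 : E + 1 / √2 ≠ 0 := by linarith
    positivity

theorem disjoint_closedBands_one {κ : ℕ} (hκ : κ = 2 ∨ κ = 3 ∨ κ = 4) :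
    ∀ E ∈ closedBands 1 κ, E ∉ muLaplacian 1 κ := by
  have hsq : (1 / √2) ^ 2 = 1 / 2 := by rw [div_pow, Real.sq_sqrt (by norm_num), one_pow]
  rcases hκ with rfl | rfl | rfl <;> simp only [closedBands] <;> intro E hE h <;>
    refine (mem_muLaplacian_one_iff.1 h).2 ?_
  · rcases hE with rfl | rfl <;> norm_num [commPoly_two]
  · rcases hE with rfl | rfl <;> norm_num [commPoly_three]
  · rcases hE with rfl | rfl | rfl <;> rw [commPoly_four]
    · norm_num
    · rw [hsq]
      norm_num
    · norm_num

theorem sq_lower_edge_three : (1 / 2 * √(1 / 2 * (5 - √7))) ^ 2 = (5 - √7) / 8 := by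
  have h7 : √7 ≤ 5 := Real.sqrt_le_iff.2 (by norm_num)
  rw [mul_pow, Real.sq_sqrt (by linarith)]
  ring

theorem sq_lower_edge_four : √(3 / 2 - 1 / √5) ^ 2 = 3 / 2 - 1 / √5 := by
  refine Real.sq_sqrt (sub_nonneg.2 ?_)
  rw [div_le_iff₀ (by positivity)]
  nlinarith [Real.le_sqrt_of_sq_le (show (1 : ℝ) ^ 2 ≤ 5 by norm_num)]

theorem lower_edge_three_lt : 1 / 2 * √(1 / 2 * (5 - √7)) < 1 := by
  have h7 : 2 < √7 := Real.lt_sqrt_of_sq_lt (by norm_num)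
  refine lt_of_pow_lt_pow_left₀ 2 zero_le_one ?_
  rw [sq_lower_edge_three]
  linarith

theorem lower_edge_four_lt : √(3 / 2 - 1 / √5) < √2 := by
  have h5 : 0 < 1 / √5 := by positivity
  exact Real.sqrt_lt_sqrt (by rw [← sq_lower_edge_four]; positivity) (by linarith)

theorem openBands_two_subset {κ : ℕ} (hκ : κ = 2 ∨ κ = 3 ∨ κ = 4) :
    openBands 2 κ ⊆ muLaplacian 2 κ := by
  rcases hκ with rfl | rfl | rfl <;> simp only [openBands]
  · rintro E ⟨h0, h1⟩
    exact mem_muLaplacian_of_top_band (a := 0) (fun x => commPoly_two_pos) (by norm_num; linarith)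
      (by norm_num; linarith) (by linarith)
  · rintro E (⟨h0, h1⟩ | ⟨h0, h1⟩)
    · have hE : 0 ≤ E := le_trans (by positivity) h0.le
      refine mem_muLaplacian_two_of_neg (abs_le.2 ⟨by linarith, by linarith⟩) fun x y hs => ?_
      refine commPoly_three_add_neg ?_ (by rw [hs]; nlinarith)
      rw [hs, ← sq_lower_edge_three]
      exact pow_lt_pow_left₀ h0 (by positivity) two_ne_zero
    · exact mem_muLaplacian_of_top_band (a := 1 / 2) (fun x => commPoly_three_pos)
        (by norm_num; linarith) (by norm_num; linarith) (by linarith)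
  · have h2 : √2 ^ 2 = 2 := Real.sq_sqrt (by norm_num)
    have h2' : 0 < √2 := by positivity
    rintro E (⟨h0, h1⟩ | ⟨h0, h1⟩)
    · have hE : 0 < E := lt_of_le_of_lt (by positivity) h0
      refine mem_muLaplacian_two_of_neg (abs_le.2 ⟨by linarith, by nlinarith⟩) fun x y hs => ?_
      refine commPoly_four_add_neg (by rw [hs]; exact hE) ?_ (by rw [hs]; nlinarith)
      rw [hs, ← sq_lower_edge_four]
      exact pow_lt_pow_left₀ h0 (by positivity) two_ne_zero
    · exact mem_muLaplacian_of_top_band (a := √2 / 2)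
        (fun x h => commPoly_four_pos (by linarith) (by nlinarith))
        (by norm_num; linarith) (by norm_num; linarith) (by linarith)

theorem openBands_three_subset {κ : ℕ} (hκ : κ = 2 ∨ κ = 3 ∨ κ = 4) :
    openBands 3 κ ⊆ muLaplacian 3 κ := by
  rcases hκ with rfl | rfl | rfl <;> simp only [openBands] <;> rintro E ⟨h0, h1⟩
  · exact mem_muLaplacian_of_top_band (a := 0) (fun x => commPoly_two_pos) (by norm_num; linarith)
      (by norm_num; linarith) (by linarith)
  · exact mem_muLaplacian_of_top_band (a := 1 / 2) (fun x => commPoly_three_pos)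
      (by norm_num; linarith) (by norm_num; linarith) (by linarith)
  · have hsq : (1 / √2) ^ 2 = 1 / 2 := by rw [div_pow, Real.sq_sqrt (by norm_num), one_pow]
    have hpos : 0 < 1 / √2 := by positivity
    exact mem_muLaplacian_of_top_band (a := 1 / √2)
      (fun x h => commPoly_four_pos (by linarith) (by nlinarith))
      (by push_cast; linarith) (by push_cast; linarith) (by linarith)

theorem disjoint_closedBands_two {κ : ℕ} (hκ : κ = 2 ∨ κ = 3 ∨ κ = 4) :
    ∀ E ∈ closedBands 2 κ, E ∉ muLaplacian 2 κ := by
  have htop (κ : ℕ) : (2 : ℝ) ∉ muLaplacian 2 κ := natCast_notMem_muLaplacian 2 κ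
  rcases hκ with rfl | rfl | rfl <;> simp only [closedBands]
  · rintro E (⟨h0, h1⟩ | rfl)
    -- The diagonal point gives a nonnegative sum. In `(1, E - 1)` the coordinate `1` contributes
    -- nothing and `E - 1 ≤ 0` a nonpositive term.
    · refine notMem_muLaplacian_two (E / 2) (E / 2) 1 (E - 1) (abs_le.2 ⟨by linarith, by linarith⟩)
        (abs_le.2 ⟨by linarith, by linarith⟩) (by ring)
        (add_nonneg (commPoly_two_nonneg (by linarith) (by linarith))
          (commPoly_two_nonneg (by linarith) (by linarith))) (by simp)
        (abs_le.2 ⟨by linarith, by linarith⟩) (by ring) ?_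
      rw [commPoly_one_right, zero_add]
      exact commPoly_two_nonpos (by linarith) (by linarith)
    · exact htop 2
  · rintro E ((⟨h0, h1⟩ | ⟨h0, h1⟩) | rfl)
    · have hE : E ^ 2 ≤ (5 - √7) / 8 := by
        rw [← sq_lower_edge_three]
        exact pow_le_pow_left₀ h0 h1 2
      have hE1 := lower_edge_three_lt
      obtain ⟨x, y, hx, hy, hs, h⟩ := exists_commPoly_three_add_nonneg h0 hE
      exact notMem_muLaplacian_two x y (E / 2) (E / 2) hx hy hs h
        (abs_le.2 ⟨by linarith, by linarith⟩) (abs_le.2 ⟨by linarith, by linarith⟩) (by ring)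
        (add_nonpos (commPoly_three_nonpos (by linarith) (by linarith))
          (commPoly_three_nonpos (by linarith) (by linarith)))
    · refine notMem_muLaplacian_two (E / 2) (E / 2) 1 (E - 1) (abs_le.2 ⟨by linarith, by linarith⟩)
        (abs_le.2 ⟨by linarith, by linarith⟩) (by ring)
        (add_nonneg (commPoly_three_nonneg (by linarith) (by linarith))
          (commPoly_three_nonneg (by linarith) (by linarith))) (by simp)
        (abs_le.2 ⟨by linarith, by linarith⟩) (by ring) ?_
      rw [commPoly_one_right, zero_add]
      exact commPoly_three_nonpos (by linarith) (by linarith)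
    · exact htop 3
  · have h2 : √2 ^ 2 = 2 := Real.sq_sqrt (by norm_num)
    have h2' : 1 < √2 := Real.lt_sqrt_of_sq_lt (by norm_num)
    have h2'' : √2 < 2 := by nlinarith
    rintro E ((⟨h0, h1⟩ | ⟨h0, h1⟩) | rfl)
    · have hE : E ^ 2 ≤ 3 / 2 - 1 / √5 := by
        rw [← sq_lower_edge_four]
        exact pow_le_pow_left₀ h0 h1 2
      have hE1 := lower_edge_four_lt
      have hE2 : (E / 2) ^ 2 ≤ 1 / 2 := by nlinarith
      obtain ⟨x, y, hx, hy, hs, h⟩ := exists_commPoly_four_add_nonneg h0 hE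
      exact notMem_muLaplacian_two x y (E / 2) (E / 2) hx hy hs h
        (abs_le.2 ⟨by linarith, by linarith⟩) (abs_le.2 ⟨by linarith, by linarith⟩) (by ring)
        (add_nonpos (commPoly_four_nonpos (by linarith) hE2)
          (commPoly_four_nonpos (by linarith) hE2))
    · have hE2 : 1 / 2 ≤ (E / 2) ^ 2 := by nlinarith
      refine notMem_muLaplacian_two (E / 2) (E / 2) 1 (E - 1) (abs_le.2 ⟨by linarith, by linarith⟩)
        (abs_le.2 ⟨by linarith, by linarith⟩) (by ring)
        (add_nonneg (commPoly_four_nonneg (by linarith) hE2 (by linarith))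
          (commPoly_four_nonneg (by linarith) hE2 (by linarith))) (by simp)
        (abs_le.2 ⟨by linarith, by linarith⟩) (by ring) ?_
      rw [commPoly_one_right, zero_add]
      exact commPoly_four_nonpos (by linarith) (by nlinarith)
    · exact htop 4

/-! ### Failure of the estimate in dimension three -/

theorem disjoint_closedBands_three_two : ∀ E ∈ closedBands 3 2, E ∉ muLaplacian 3 2 := by
  simp only [closedBands]
  rintro E (⟨h0, h1⟩ | rfl)
  · have hx : |E / 3| ≤ 1 := abs_le.2 ⟨by linarith, by linarith⟩
    have hp := commPoly_two_nonneg (x := E / 3) (by linarith) (by linarith)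
    rcases le_total E 1 with hE | hE
    · refine notMem_muLaplacian_three (E / 3) (E / 3) (E / 3) 1 (E - 1) 0 hx hx hx (by ring)
        (by linarith) (by simp) (abs_le.2 ⟨by linarith, by linarith⟩) (by simp) (by ring) ?_
      have := commPoly_two_nonpos (x := E - 1) (by linarith) (by linarith)
      have h0 : commPoly 2 0 = 0 := by rw [commPoly_two]; ring
      rw [commPoly_one_right, h0]
      linarith
    · refine notMem_muLaplacian_three (E / 3) (E / 3) (E / 3) 1 1 (E - 2) hx hx hx (by ring)
        (by linarith) (by simp) (by simp) (abs_le.2 ⟨by linarith, by linarith⟩) (by ring) ?_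
      have := commPoly_two_nonpos (x := E - 2) (by linarith) (by linarith)
      rw [commPoly_one_right]
      linarith
  · exact natCast_notMem_muLaplacian 3 2

theorem disjoint_closedBands_three_three : ∀ E ∈ closedBands 3 3, E ∉ muLaplacian 3 3 := by
  simp only [closedBands]
  rintro E (⟨h0, h1⟩ | rfl)
  · have hx : |E / 3| ≤ 1 := abs_le.2 ⟨by linarith, by linarith⟩
    have h34 : |(3 / 4 : ℝ)| ≤ 1 := by norm_num [abs_le]
    have h34' : |(-(3 / 4) : ℝ)| ≤ 1 := by norm_num [abs_le]
    have hp34 : commPoly 3 (3 / 4) = 35 / 64 := by norm_num [commPoly_three]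
    have hp34' : commPoly 3 (-(3 / 4)) = 35 / 64 := by norm_num [commPoly_three]
    rcases le_total E (3 / 2) with hE | hE
    · have hp := commPoly_three_nonpos (x := E / 3) (by linarith) (by linarith)
      rcases le_total E 1 with hE1 | hE1
      · have hz : |E| ≤ 1 := abs_le.2 ⟨by linarith, by linarith⟩
        have := neg_one_le_commPoly_three hz
        -- Two coordinates `±3/4` contribute `70/64 > 1`, which outweighs any third term since that
        -- is at least `-1`.
        exact notMem_muLaplacian_three (3 / 4) (-(3 / 4)) E (E / 3) (E / 3) (E / 3) h34 h34' hz
          (by ring) (by linarith) hx hx hx (by ring) (by linarith)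
      · have hz : |E - 3 / 2| ≤ 1 := abs_le.2 ⟨by linarith, by linarith⟩
        have := neg_one_le_commPoly_three hz
        exact notMem_muLaplacian_three (3 / 4) (3 / 4) (E - 3 / 2) (E / 3) (E / 3) (E / 3) h34 h34
          hz (by ring) (by linarith) hx hx hx (by ring) (by linarith)
    · have hp := commPoly_three_nonneg (x := E / 3) (by linarith) (by linarith)
      refine notMem_muLaplacian_three (E / 3) (E / 3) (E / 3) 1 1 (E - 2) hx hx hx (by ring)
        (by linarith) (by simp) (by simp) (abs_le.2 ⟨by linarith, by linarith⟩) (by ring) ?_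
      have := commPoly_three_nonpos (x := E - 2) (by linarith) (by linarith)
      rw [commPoly_one_right]
      linarith
  · exact natCast_notMem_muLaplacian 3 3

theorem disjoint_closedBands_three_four : ∀ E ∈ closedBands 3 4, E ∉ muLaplacian 3 4 := by
  have hsq : (1 / √2) ^ 2 = 1 / 2 := by rw [div_pow, Real.sq_sqrt (by norm_num), one_pow]
  have hlow : 7 / 10 < 1 / √2 := lt_of_pow_lt_pow_left₀ 2 (by positivity) (by rw [hsq]; norm_num)
  have hhigh : 1 / √2 < 3 / 4 := lt_of_pow_lt_pow_left₀ 2 (by positivity) (by rw [hsq]; norm_num)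
  simp only [closedBands]
  rintro E ((⟨h0, h1⟩ | ⟨h0, h1⟩) | rfl)
  · have hx : |E / 3| ≤ 1 := abs_le.2 ⟨by linarith, by linarith⟩
    have hp := commPoly_four_nonpos (x := E / 3) (by linarith) (by nlinarith)
    rcases le_total E (3 / 2) with hE | hE
    · have hz : |E - 1 / 2| ≤ 1 := abs_le.2 ⟨by linarith, by linarith⟩
      have := neg_one_le_commPoly_four hz
      -- The points `7/8` and `-3/8` together contribute at least `1`, outweighing the third
      -- coordinate `E - 1/2`.
      have h7 : 0 ≤ commPoly 4 (7 / 8) + commPoly 4 (-(3 / 8)) - 1 := by norm_num [commPoly_four]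
      exact notMem_muLaplacian_three (7 / 8) (-(3 / 8)) (E - 1 / 2) (E / 3) (E / 3) (E / 3)
        (by norm_num [abs_le]) (by norm_num [abs_le]) hz (by ring) (by linarith) hx hx hx (by ring)
        (by linarith)
    · have hy : |E / 2| ≤ 1 := abs_le.2 ⟨by linarith, by linarith⟩
      have hp2 := commPoly_four_nonneg (x := E / 2) (by linarith) (by nlinarith) (by linarith)
      have h0 : commPoly 4 0 = 0 := by rw [commPoly_four]; ring
      exact notMem_muLaplacian_three (E / 2) (E / 2) 0 (E / 3) (E / 3) (E / 3) hy hy (by simp)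
        (by ring) (by linarith) hx hx hx (by ring) (by linarith)
  · have hE3 : 1 / √2 ≤ E / 3 := by
      rw [show (3 : ℝ) / √2 = 3 * (1 / √2) by ring] at h0
      linarith
    have hx : |E / 3| ≤ 1 := abs_le.2 ⟨by linarith, by linarith⟩
    have hp := commPoly_four_nonneg (x := E / 3) (by linarith) (by nlinarith) (by linarith)
    refine notMem_muLaplacian_three (E / 3) (E / 3) (E / 3) 1 1 (E - 2) hx hx hx (by ring)
      (by linarith) (by simp) (by simp) (abs_le.2 ⟨by linarith, by linarith⟩) (by ring) ?_
    have := commPoly_four_nonpos (x := E - 2) (by linarith) (by nlinarith)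
    rw [commPoly_one_right]
    linarith
  · exact natCast_notMem_muLaplacian 3 4

theorem bands_subset_Icc {d κ : ℕ} (hd : d = 1 ∨ d = 2 ∨ d = 3) (hκ : κ = 2 ∨ κ = 3 ∨ κ = 4) :
    openBands d κ ∪ closedBands d κ ⊆ Icc 0 (d : ℝ) := by
  have hsq : (1 / √2) ^ 2 = 1 / 2 := by rw [div_pow, Real.sq_sqrt (by norm_num), one_pow]
  have hpos : 0 < 1 / √2 := by positivity
  have hlt : 1 / √2 < 1 := lt_of_pow_lt_pow_left₀ 2 zero_le_one (by rw [hsq]; norm_num)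
  have h2 : √2 ^ 2 = 2 := Real.sq_sqrt (by norm_num)
  have h2' : 1 < √2 := Real.lt_sqrt_of_sq_lt (by norm_num)
  have h2'' : √2 < 2 := by nlinarith
  have h3 := lower_edge_three_lt
  have h3' : 0 ≤ 1 / 2 * √(1 / 2 * (5 - √7)) := by positivity
  have h4 := lower_edge_four_lt
  have h4' : 0 ≤ √(3 / 2 - 1 / √5) := by positivity
  have h5 : 3 / √2 = 3 * (1 / √2) := by ring
  rcases hd with rfl | rfl | rfl <;> rcases hκ with rfl | rfl | rfl <;>
    simp only [openBands, closedBands, h5] <;> intro E hE <;>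
    simp only [mem_union, mem_Ioo, mem_Icc, mem_Ico, mem_insert_iff, mem_singleton_iff,
      mem_sdiff, Nat.cast_one, Nat.cast_ofNat] at hE ⊢ <;>
    casesm* _ ∨ _, _ ∧ _ <;> constructor <;> linarith

/-- This covering turns the two inclusions into an equality. For `(3, 4)` the interval `(2, 3/√2)`
is in neither list. -/
theorem Icc_subset_bands {d κ : ℕ} (hd : d = 1 ∨ d = 2 ∨ d = 3) (hκ : κ = 2 ∨ κ = 3 ∨ κ = 4)
    (h : ¬(d = 3 ∧ κ = 4)) : Icc 0 (d : ℝ) ⊆ openBands d κ ∪ closedBands d κ := by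
  rcases hd with rfl | rfl | rfl <;> rcases hκ with rfl | rfl | rfl <;>
    simp only [openBands, closedBands] <;> intro E hE <;>
    simp only [mem_union, mem_Ioo, mem_Icc, mem_Ico, mem_insert_iff, mem_singleton_iff,
      mem_sdiff] at hE ⊢ <;> grind

end LatticeMourre

theorem mainTheorem5 (d κ : ℕ) (hd : d = 1 ∨ d = 2 ∨ d = 3) (hκ : κ = 2 ∨ κ = 3 ∨ κ = 4) :
    -- the set is symmetric about zero
    (∀ E : ℝ, E ∈ LatticeMourre.muLaplacian d κ ↔ -E ∈ LatticeMourre.muLaplacian d κ) ∧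
    -- the listed energies in `[0, d]` at which the strict Mourre estimate holds
    LatticeMourre.openBands d κ ⊆ LatticeMourre.muLaplacian d κ ∩ Set.Icc 0 (d : ℝ) ∧
    -- the listed energies in `[0, d]` at which it fails
    LatticeMourre.closedBands d κ ⊆ Set.Icc 0 (d : ℝ) \ LatticeMourre.muLaplacian d κ ∧
    -- the list is complete, except for `d = 3`, `κ = 4`
    (¬(d = 3 ∧ κ = 4) → LatticeMourre.muLaplacian d κ =
      {E : ℝ | E ∈ LatticeMourre.openBands d κ ∨ -E ∈ LatticeMourre.openBands d κ}) := by
  have hsymm (E : ℝ) (hE : -E ∈ LatticeMourre.muLaplacian d κ) :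
      E ∈ LatticeMourre.muLaplacian d κ := by
    simpa using LatticeMourre.neg_mem_muLaplacian hE
  have hopen : LatticeMourre.openBands d κ ⊆ LatticeMourre.muLaplacian d κ := by
    rcases hd with rfl | rfl | rfl
    · exact LatticeMourre.openBands_one_subset hκ
    · exact LatticeMourre.openBands_two_subset hκ
    · exact LatticeMourre.openBands_three_subset hκ
  have hclosed : ∀ E ∈ LatticeMourre.closedBands d κ, E ∉ LatticeMourre.muLaplacian d κ := by
    rcases hd with rfl | rfl | rfl
    · exact LatticeMourre.disjoint_closedBands_one hκ
    · exact LatticeMourre.disjoint_closedBands_two hκ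
    · rcases hκ with rfl | rfl | rfl
      · exact LatticeMourre.disjoint_closedBands_three_two
      · exact LatticeMourre.disjoint_closedBands_three_three
      · exact LatticeMourre.disjoint_closedBands_three_four
  have hIcc := LatticeMourre.bands_subset_Icc hd hκ
  refine ⟨fun E => ⟨LatticeMourre.neg_mem_muLaplacian, hsymm E⟩,
    fun E hE => ⟨hopen hE, hIcc (.inl hE)⟩, fun E hE => ⟨hIcc (.inr hE), hclosed E hE⟩,
    fun h => Set.Subset.antisymm ?_ ?_⟩
  · have hnonneg (E : ℝ) (h0 : 0 ≤ E) (hE : E ∈ LatticeMourre.muLaplacian d κ) :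
        E ∈ LatticeMourre.openBands d κ := by
      have hEd := ((LatticeMourre.mem_muLaplacian_iff d κ E).1 hE).1
      rcases LatticeMourre.Icc_subset_bands hd hκ h ⟨h0, (abs_le.1 hEd).2⟩ with h1 | h1
      · exact h1
      · exact absurd hE (hclosed E h1)
    intro E hE
    rcases le_total 0 E with h0 | h0
    · exact .inl (hnonneg E h0 hE)
    · exact .inr (hnonneg (-E) (neg_nonneg.2 h0) (LatticeMourre.neg_mem_muLaplacian hE))
  · rintro E (hE | hE)
    · exact hopen hE
    · exact hsymm E (hopen hE)
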